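/- Let $S$ be an abelian semigroup with unit $e$, equipped with a locally compact Hausdorff topology for which multiplication is separately continuous (a locally compact semitopological semigroup), and suppose that $e$ is the only invertible element of $S$. Let $\mathcal M(S)$ be the Banach algebra of all complex bounded regular Borel measures on $S$ with the total variation norm, where the convolution is defined by $$\int_S f\,d(\mu\ast\nu)=\int_S\int_S f(xy)\,d\mu(x)\,d\nu(y)\qquad (f\in C^b(S)).$$ Let $S^*_1$ be the set of all homomorphisms $\rho$ from $S$ to the multiplicative semigroup $[0,1]$ that are not identically zero and are $\mu$-measurable for all $\mu\in\mathcal M(S)$, with the topology of pointwise convergence; let $\mathbf 1\in S^*_1$ be the constant function $1$ and $1_e\in S^*_1$ the indicator function of $\{e\}$. Suppose that there is $\rho\in S^*_1$ with $0<\rho(s)<1$ for all $s\in S\setminus\{e\}$. Then: (a) $\rho_t:=\rho^{t/(1-t)}$ for $t\in[0,1)$, $\rho_1:=1_e$, defines a continuous path in $S^*_1$ from $\mathbf 1$ to $1_e$. (b) Let $\mathcal R$ be a unital Banach subalgebra of $\mathcal M(S)$ (a norm closed subalgebra that contains the unit $\delta_e$) with the following property (1): there is a continuous path $(\rho_t)_{t\in[0,1]}$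 in $S^*_1$ from $\mathbf 1$ to $1_e$ (for instance the path in (a)) such that $$\rho_t\cdot\mu\in\mathcal R\quad\text{for all }\mu\in\mathcal R,\ t\in[0,1],$$ where $\rho_t\cdot\mu$ is the measure with density $\rho_t$ with respect to $\mu$. Then the Gelfand spectrum of $\mathcal R$ (the set of nonzero continuous multiplicative linear functionals on $\mathcal R$, with the weak-$*$ topology) is contractible. -/

import Mathlib

open MeasureTheory
open scoped BoundedContinuousFunction unitInterval

noncomputable section

namespace SemigroupMeasure

/-- A measure dominated by a finite regular Borel measure on a Hausdorff space is regular. -/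
theorem regular_of_le {X : Type*} [TopologicalSpace X] [T2Space X] [MeasurableSpace X]
    [BorelSpace X] {m n : Measure X} [IsFiniteMeasure n] [n.Regular] (h : m ≤ n) :
    m.Regular := by
  have : IsFiniteMeasure m := isFiniteMeasure_of_le n h
  have : m.InnerRegularCompactLTTop := by
    refine ⟨?_⟩
    rintro U ⟨hU, -⟩ r hr
    obtain ⟨K, hKU, hK, hlt⟩ := hU.exists_isCompact_sdiff_lt (μ := n) (measure_ne_top n U)
      (ε := m U - r) (tsub_pos_of_lt hr).ne'
    refine ⟨K, hKU, hK, ?_⟩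
    have h1 : m (U \ K) < m U - r := lt_of_le_of_lt (h _) hlt
    by_contra hcon
    push Not at hcon
    have h2 : m U ≤ m K + m (U \ K) := by
      calc m U = m (K ∪ U \ K) := by rw [Set.union_sdiff_cancel hKU]
        _ ≤ _ := measure_union_le _ _
    have h3 : m U < r + (m U - r) :=
      lt_of_le_of_lt h2 (ENNReal.add_lt_add_of_le_of_lt (measure_ne_top m K) hcon h1)
    rw [add_tsub_cancel_of_le hr.le] at h3
    exact lt_irrefl _ h3
  infer_instance

/-- The space `M(S)` of complex bounded regular Borel measures on `S`: complex measures whose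
total variation measure `|μ|` is finite and regular. -/
def M (S : Type*) [TopologicalSpace S] [T2Space S] [MeasurableSpace S] [BorelSpace S] :
    Submodule ℂ (ComplexMeasure S) where
  carrier := {μ | IsFiniteMeasure μ.variation ∧ μ.variation.Regular}
  zero_mem' := by
    simp only [Set.mem_ofPred_eq, VectorMeasure.variation_zero]
    exact ⟨inferInstance, inferInstance⟩
  add_mem' := by
    rintro μ ν ⟨hμ, hμ'⟩ ⟨hν, hν'⟩
    have : (μ.variation + ν.variation).Regular := inferInstance
    exact ⟨isFiniteMeasure_of_le _ VectorMeasure.variation_add_le,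
      regular_of_le VectorMeasure.variation_add_le⟩
  smul_mem' := by
    rintro c μ ⟨hμ, hμ'⟩
    simp only [Set.mem_ofPred_eq, VectorMeasure.variation_smul]
    exact ⟨inferInstance, inferInstance⟩

section Norm

variable {S : Type*} [TopologicalSpace S] [T2Space S] [MeasurableSpace S] [BorelSpace S]

instance (μ : M S) : IsFiniteMeasure (μ : ComplexMeasure S).variation := μ.2.1

instance (μ : M S) : (μ : ComplexMeasure S).variation.Regular := μ.2.2

/-- The total variation norm `‖μ‖ = |μ|(S)`. -/
instance : Norm (M S) := ⟨fun μ => (μ : ComplexMeasure S).variation.real Set.univ⟩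

theorem norm_def (μ : M S) : ‖μ‖ = (μ : ComplexMeasure S).variation.real Set.univ := rfl

theorem normCore : NormedSpace.Core ℂ (M S) where
  norm_nonneg μ := measureReal_nonneg
  norm_smul c μ := by
    simp [norm_def, VectorMeasure.variation_smul, measureReal_def]
  norm_triangle μ ν := by
    have h := (VectorMeasure.variation_add_le (μ := (μ : ComplexMeasure S))
      (ν := (ν : ComplexMeasure S))) Set.univ
    rw [Measure.add_apply] at h
    simp only [norm_def, measureReal_def]
    rw [← ENNReal.toReal_add (measure_ne_top _ _) (measure_ne_top _ _)]
    exact ENNReal.toReal_mono (by finiteness) h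
  norm_eq_zero_iff μ := by
    rw [norm_def, measureReal_eq_zero_iff, Measure.measure_univ_eq_zero,
      VectorMeasure.variation_eq_zero, ZeroMemClass.coe_eq_zero]

instance : NormedAddCommGroup (M S) := NormedAddCommGroup.ofCore normCore

instance : NormedSpace ℂ (M S) := NormedSpace.ofCore normCore

/-- The Dirac measure `δ_s`. -/
def dirac (s : S) : M S :=
  ⟨VectorMeasure.dirac s 1, by
    refine ⟨inferInstance, ?_⟩
    have : (Measure.dirac s : Measure S).InnerRegularCompactLTTop := by
      refine ⟨?_⟩
      rintro U ⟨hU, -⟩ r hr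
      by_cases hs : s ∈ U
      · exact ⟨{s}, by simpa using hs, isCompact_singleton, by simpa [hs] using hr⟩
      · rw [Measure.dirac_apply' _ hU] at hr
        simp [hs] at hr
    rw [VectorMeasure.variation_dirac, enorm_one, one_smul]
    infer_instance⟩

end Norm

section Convolution

variable {S : Type*} [TopologicalSpace S] [T2Space S] [MeasurableSpace S] [BorelSpace S]

/-- The integral `∫ f dμ` of a complex function with respect to a complex measure. -/
def integral (f : S → ℂ) (μ : M S) : ℂ :=
  (μ : ComplexMeasure S).integral f (ContinuousLinearMap.mul ℝ ℂ)

/-- `κ` is the convolution of `μ` and `ν`: for all bounded continuous `f : S → ℂ`,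
`∫ f dκ = ∫ (∫ f(xy) dμ(x)) dν(y)`. -/
def IsConv [Mul S] (μ ν κ : M S) : Prop :=
  ∀ f : S →ᵇ ℂ, integral f κ = integral (fun y => integral (fun x => f (x * y)) μ) ν

open scoped Classical in
/-- The convolution `μ ∗ ν`: the (unique) element of `M(S)` with
`∫ f d(μ ∗ ν) = ∫ (∫ f(xy) dμ(x)) dν(y)` for all bounded continuous `f`. (On a locally compact
semitopological semigroup it always exists; the value `0` in the other case is a convention.) -/
def conv [Mul S] (μ ν : M S) : M S :=
  if h : ∃ κ : M S, IsConv μ ν κ then h.choose else 0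

end Convolution

section Characters

variable (S : Type*) [CommMonoid S] [TopologicalSpace S] [T2Space S] [MeasurableSpace S]
  [BorelSpace S]

/-- The set `S*₁` of semicharacters: homomorphisms from `S` to the multiplicative semigroup
`[0, 1]` that are not identically zero and are `μ`-measurable for all `μ ∈ M(S)`. As a subset of
`S → ℝ` it carries the topology of pointwise convergence. -/
def SStar : Set (S → ℝ) :=
  {ρ | (∀ s, 0 ≤ ρ s ∧ ρ s ≤ 1) ∧ (∀ a b, ρ (a * b) = ρ a * ρ b) ∧ (∃ s, ρ s ≠ 0) ∧
    ∀ μ : M S, AEMeasurable ρ (μ : ComplexMeasure S).variation}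

variable {S}

/-- The product `ρ · μ` of a semicharacter and a measure, `(ρ · μ)(E) = ∫_E ρ dμ`. -/
def density (ρ : SStar S) (μ : M S) : M S :=
  ⟨(μ : ComplexMeasure S).withDensity (ρ : S → ℝ) (ContinuousLinearMap.lsmul ℝ ℝ), by
    have h : ((μ : ComplexMeasure S).withDensity (ρ : S → ℝ)
        (ContinuousLinearMap.lsmul ℝ ℝ)).variation ≤ (μ : ComplexMeasure S).variation := by
      refine VectorMeasure.variation_WithDensity_le.trans ?_
      rw [VectorMeasure.variation_transpose_lsmul]
      refine (withDensity_mono (g := 1) (ae_of_all _ fun s => ?_)).trans_eq withDensity_one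
      rw [Real.enorm_eq_ofReal (ρ.2.1 s).1]
      exact ENNReal.ofReal_le_one.2 (ρ.2.1 s).2
    exact ⟨isFiniteMeasure_of_le _ h, regular_of_le h⟩⟩

end Characters

section Algebra

/-- A unital Banach subalgebra of `M(S)`: a norm closed complex linear subspace that is closed
under convolution and contains the unit `δ_e` of `M(S)`. -/
structure BanachSubalgebra (S : Type*) [CommMonoid S] [TopologicalSpace S] [T2Space S]
    [MeasurableSpace S] [BorelSpace S] extends Submodule ℂ (M S) where
  isClosed' : IsClosed (carrier : Set (M S))
  conv_mem' : ∀ μ ∈ carrier, ∀ ν ∈ carrier, conv μ ν ∈ carrier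
  one_mem' : dirac (1 : S) ∈ carrier

variable {S : Type*} [CommMonoid S] [TopologicalSpace S] [T2Space S] [MeasurableSpace S]
  [BorelSpace S]

/-- The Gelfand spectrum `Δ R`: nonzero continuous linear functionals on `R` that are
multiplicative for the convolution, with the Gelfand (weak-*) topology. -/
def GelfandSpectrum (R : BanachSubalgebra S) : Set (WeakDual ℂ R.toSubmodule) :=
  {φ | φ ≠ 0 ∧ ∀ μ ν : R.toSubmodule,
    φ ⟨conv (μ : M S) (ν : M S), R.conv_mem' μ μ.2 ν ν.2⟩ = φ μ * φ ν}

/-- `γ` is a continuous path in `S*₁` (parametrized by `[0, 1]`) that starts at the constant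
semicharacter `1` and ends at the indicator function `1_e` of `{e}`. -/
def IsPathToUnit (γ : C(I, SStar S)) : Prop :=
  (γ 0 : S → ℝ) = (fun _ => 1) ∧ (γ 1 : S → ℝ) = Set.indicator {1} (fun _ => 1)

/-- `R` is stable under multiplication by the semicharacters of the path `γ`:
`ρ_t · μ ∈ R` for all `μ ∈ R` and `t ∈ [0, 1]`. -/
def StableUnder (R : BanachSubalgebra S) (γ : C(I, SStar S)) : Prop :=
  ∀ μ ∈ R.toSubmodule, ∀ t : I, density (γ t) μ ∈ R.toSubmodule

end Algebra

end SemigroupMeasure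

end

/-! Multiplication by a semicharacter is an algebra endomorphism: since `ρ (x * y) = ρ x * ρ y`, the
map `μ ↦ ρ · μ` respects convolution (`density_conv`); it also has norm at most one and fixes `δ_e`.
Hence `φ ↦ φ (ρ_t · ·)` maps the spectrum of a stable `R` to itself. At `t = 0` this is the
identity; at `t = 1` it is constant, because `1_e · μ = μ({e}) δ_e`. It is a homotopy because `t ↦
ρ_t · μ` is norm continuous by dominated convergence (`continuous_density`) and the characters are
uniformly bounded (`norm_apply_le_of_mem_GelfandSpectrum`).

Most of the work makes convolution available. Multiplication is only separately continuous, so `(x,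
y) ↦ f (x * y)` need not be jointly measurable and Fubini on the product is not at hand. For
positive `m`, `n` the convolution is built as `E ↦ ∫ m {x | x * y ∈ E} dn(y)`. For open `E` the
integrand is lower semicontinuous, being a supremum of integrals of `x ↦ f (x * y)` over compact
sets; these are continuous in `y` by an Eberlein-Grothendieck argument that replaces nets by
sequences, so that dominated convergence applies. The same suprema and `τ`-additivity give
regularity. Decomposition into four positive measures extends everything to `M S`, and uniqueness
(`eq_of_forall_integral_eq`) identifies the result with `conv`.

For the explicit path, `x ^ (t / (1 - t)) → 0` as `t → 1` when `0 < x < 1`. -/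

namespace SemigroupMeasure

open Filter Topology Set
open scoped ENNReal NNReal

/-! ### Sequential approximation for separately continuous functions on compact spaces -/

section PointwiseCompactness

variable {X Y : Type*} {F : X → Y → ℝ}

/-- Finitely many continuous functions vary by less than `ε` on a neighbourhood of each point;
compactness leaves finitely many centres. -/
theorem exists_finset_net [TopologicalSpace X] [CompactSpace X] (hX : ∀ y, Continuous fun x => F x y) (A : Finset Y) {ε : ℝ}
    (hε : 0 < ε) : ∃ D : Finset X, ∀ x, ∃ d ∈ D, ∀ y ∈ A, |F x y - F d y| < ε := by
  have hU : ∀ d : X, {x | ∀ y ∈ A, |F x y - F d y| < ε} ∈ 𝓝 d := fun d => by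
    refine (Filter.eventually_all_finset A).2 fun y _ => ?_
    have : ContinuousAt (fun x => |F x y - F d y|) d :=
      (((hX y).sub continuous_const).abs).continuousAt
    exact this.eventually_lt continuousAt_const (by simpa using hε)
  obtain ⟨D, -, hD⟩ := isCompact_univ.elim_nhds_subcover _ fun d _ => hU d
  refine ⟨D, fun x => ?_⟩
  have hx := hD (mem_univ x)
  simp only [mem_iUnion] at hx
  obtain ⟨d, hd, hx⟩ := hx
  exact ⟨d, hd, hx⟩

theorem exists_mem_forall_finset_lt [TopologicalSpace Y] (hY : ∀ x, Continuous (F x)) {B : Set Y} {y₀ : Y}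
    (h : y₀ ∈ closure B) (D : Finset X) {ε : ℝ} (hε : 0 < ε) :
    ∃ y ∈ B, ∀ d ∈ D, |F d y - F d y₀| < ε := by
  have hU : ∀ᶠ y in 𝓝 y₀, ∀ d ∈ D, |F d y - F d y₀| < ε := by
    refine (Filter.eventually_all_finset D).2 fun d _ => ?_
    have : ContinuousAt (fun y => |F d y - F d y₀|) y₀ :=
      (((hY d).sub continuous_const).abs).continuousAt
    exact this.eventually_lt continuousAt_const (by simpa using hε)
  obtain ⟨y, hyB, hy⟩ := ((mem_closure_iff_frequently.1 h).and_eventually hU).exists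
  exact ⟨y, hyB, hy⟩

/-- A form of the theorems of Eberlein and Grothendieck: for a separately continuous function on a
product of compact spaces, closure points in one variable are reached, pointwise in the other
variable, by sequences. -/
theorem exists_seq_tendsto_of_mem_closure [TopologicalSpace X] [CompactSpace X]
    [TopologicalSpace Y] [CompactSpace Y]
    (hX : ∀ y, Continuous fun x => F x y) (hY : ∀ x, Continuous (F x))
    {B : Set Y} {y₀ : Y} (h : y₀ ∈ closure B) :
    ∃ u : ℕ → Y, (∀ n, u n ∈ B) ∧ ∀ x, Tendsto (fun n => F x (u n)) atTop (𝓝 (F x y₀)) := by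
  classical
  choose net hnet using fun (A : Finset Y) (n : ℕ) =>
    exists_finset_net hX A (Nat.one_div_pos_of_nat (α := ℝ) (n := n))
  choose pick hpickB hpick using fun (D : Finset X) (n : ℕ) =>
    exists_mem_forall_finset_lt hY h D (Nat.one_div_pos_of_nat (α := ℝ) (n := n))
  -- Stage `n` holds a finite set in `Y` (with `y₀` and all earlier picks) and a finite set `D` in
  -- `X`. The new pick from `B` is close to `y₀` on `D`; then `D` grows by a net of `X` relative to
  -- the enlarged set in `Y`. Both errors are `1 / (n + 1)`.
  let s : ℕ → Finset Y × Finset X := fun n => Nat.rec ({y₀}, ∅) (fun n p =>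
    (insert (pick p.2 n) p.1, p.2 ∪ net (insert (pick p.2 n) p.1) n)) n
  have hs : ∀ n, s (n + 1) = (insert (pick (s n).2 n) (s n).1,
    (s n).2 ∪ net (insert (pick (s n).2 n) (s n).1) n) := fun n => rfl
  set u : ℕ → Y := fun n => pick (s n).2 n with hu
  have hm1 : Monotone fun n => (s n).1 := monotone_nat_of_le_succ fun n => by
    simp only [hs]; exact Finset.subset_insert _ _
  have hm2 : Monotone fun n => (s n).2 := monotone_nat_of_le_succ fun n => by
    simp only [hs]; exact Finset.subset_union_left
  have hu1 : ∀ n, u n ∈ (s (n + 1)).1 := fun n => by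
    simp only [hs]; exact Finset.mem_insert_self _ _
  have hy₀ : ∀ n, y₀ ∈ (s n).1 := fun n => hm1 (Nat.zero_le n) (by simp [s])
  have hd : ∀ x n, ∃ d ∈ (s (n + 1)).2, ∀ y ∈ (s (n + 1)).1,
      |F x y - F d y| < 1 / ((n : ℝ) + 1) := fun x n => by
    obtain ⟨d, hd, h⟩ := hnet (s (n + 1)).1 n x
    exact ⟨d, by rw [hs]; exact Finset.mem_union_right _ hd, h⟩
  have hlim : ∀ m, ∀ d ∈ (s m).2, Tendsto (fun n => F d (u n)) atTop (𝓝 (F d y₀)) := by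
    intro m d hd
    rw [tendsto_iff_dist_tendsto_zero]
    refine squeeze_zero' (Eventually.of_forall fun _ => dist_nonneg) ?_
      tendsto_one_div_add_atTop_nhds_zero_nat
    filter_upwards [eventually_ge_atTop m] with n hn
    exact (hpick (s n).2 n d (hm2 hn hd)).le
  refine ⟨u, fun n => hpickB _ _, fun x => ?_⟩
  -- Double limit argument: along an ultrafilter, `u` converges to some `y` and the net points `d n`
  -- approximating `x` converge to some `x'`.
  rw [tendsto_iff_ultrafilter]
  intro U hU
  obtain ⟨y, -, hy⟩ := isCompact_univ.ultrafilter_le_nhds (U.map u) (by simp)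
  have hy : Tendsto u U (𝓝 y) := hy
  have hFy : ∀ x, Tendsto (fun n => F x (u n)) U (𝓝 (F x y)) := fun x =>
    ((hY x).tendsto y).comp hy
  suffices F x y = F x y₀ from this ▸ hFy x
  have hDy : ∀ m, ∀ d ∈ (s m).2, F d y = F d y₀ := fun m d hd =>
    tendsto_nhds_unique (hFy d) ((hlim m d hd).mono_left hU)
  choose d hds hdx using hd x
  obtain ⟨x', -, hx'⟩ := isCompact_univ.ultrafilter_le_nhds (U.map d) (by simp)
  have hx' : Tendsto d U (𝓝 x') := hx'
  have hFx : ∀ y, Tendsto (fun n => F (d n) y) U (𝓝 (F x' y)) := fun y =>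
    ((hX y).tendsto x').comp hx'
  have hxx : ∀ m, ∀ z ∈ (s m).1, F x' z = F x z := by
    intro m z hz
    refine tendsto_nhds_unique (hFx z) (Tendsto.mono_left ?_ hU)
    rw [tendsto_iff_dist_tendsto_zero]
    refine squeeze_zero' (Eventually.of_forall fun _ => dist_nonneg) ?_
      tendsto_one_div_add_atTop_nhds_zero_nat
    filter_upwards [eventually_ge_atTop m] with n hn
    rw [dist_comm]
    exact (hdx n z (hm1 (hn.trans n.le_succ) hz)).le
  -- `x` and `x'` agree on every `u n`, hence at the limit `y`; `y` and `y₀` agree on every `d n`,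
  -- hence at the limit `x'`; and `y₀` was put in at stage `0`.
  calc F x y = F x' y := by
        refine tendsto_nhds_unique (hFy x) ((hFy x').congr fun n => ?_)
        exact hxx (n + 1) _ (hu1 n)
    _ = F x' y₀ := by
        refine tendsto_nhds_unique (hFx y) ((hFx y₀).congr fun n => ?_)
        exact (hDy (n + 1) _ (hds n)).symm
    _ = F x y₀ := hxx 0 y₀ (hy₀ 0)

end PointwiseCompactness

/-! ### Continuity of partial integrals and `τ`-additivity -/

/-- Integrating a bounded separately continuous function over a compact set in one variable gives a
continuous function of the other variable. -/
theorem continuous_setIntegral_of_separately_continuous {X Y : Type*} [TopologicalSpace X]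
    [MeasurableSpace X] [OpensMeasurableSpace X] [TopologicalSpace Y] [LocallyCompactSpace Y]
    {F : X → Y → ℝ} (hX : ∀ y, Continuous fun x => F x y) (hY : ∀ x, Continuous (F x))
    {C : ℝ} (hC : ∀ x y, |F x y| ≤ C) (m : Measure X) [IsFiniteMeasure m] {K : Set X}
    (hK : IsCompact K) (hKm : MeasurableSet K) : Continuous fun y => ∫ x in K, F x y ∂m := by
  rw [continuous_iff_continuousAt]
  intro y₀
  obtain ⟨L, hL, hLy⟩ := exists_compact_mem_nhds y₀
  have := isCompact_iff_compactSpace.1 hK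
  have := isCompact_iff_compactSpace.1 hL
  refine ContinuousWithinAt.continuousAt (s := L) ?_ hLy
  rw [continuousWithinAt_iff_continuousAt_domRestrict _ (mem_of_mem_nhds hLy),
    Metric.continuousAt_iff']
  -- Failure of continuity puts `y₀` in the closure of the bad points of `L`. A sequence of bad
  -- points converging pointwise on `K` then contradicts dominated convergence.
  by_contra! hcon
  obtain ⟨ε, hε, hcon⟩ := hcon
  obtain ⟨u, huB, hu⟩ := exists_seq_tendsto_of_mem_closure (X := K) (Y := L)
    (F := fun x y => F x y) (fun y => (hX y).comp continuous_subtype_val)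
    (fun x => (hY x).comp continuous_subtype_val) (mem_closure_iff_frequently.2 hcon)
  have hlim : Tendsto (fun n => ∫ x in K, F x (u n) ∂m) atTop
      (𝓝 (∫ x in K, F x y₀ ∂m)) := by
    refine tendsto_integral_of_dominated_convergence (fun _ => C)
      (fun n => (hX _).measurable.aestronglyMeasurable) (integrable_const C)
      (fun n => ae_of_all _ fun x => hC _ _) ?_
    filter_upwards [ae_restrict_mem hKm] with x hx using hu ⟨x, hx⟩
  obtain ⟨n, hn⟩ := ((Metric.tendsto_nhds.1 hlim ε hε)).exists
  exact absurd hn (not_lt.2 (huB n))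

/-- `τ`-additivity of finite regular measures: the integral of a directed supremum of lower
semicontinuous functions is approximated by the integrals of the functions. -/
theorem lintegral_le_of_directed_lowerSemicontinuous {Y : Type*} [TopologicalSpace Y] [T2Space Y]
    [MeasurableSpace Y] [BorelSpace Y] (n : Measure Y) [IsFiniteMeasure n] [n.Regular]
    {ι : Type*} [Nonempty ι] {G : ι → Y → ℝ≥0∞} (hG : ∀ i, LowerSemicontinuous (G i))
    (hdir : Directed (· ≤ ·) G) {h : Y → ℝ≥0} {M : ℝ≥0} (hM : ∀ y, h y ≤ M)
    (hh : ∀ y, (h y : ℝ≥0∞) ≤ ⨆ i, G i y) {c : ℝ≥0∞} (hc : ∀ i, ∫⁻ y, G i y ∂n ≤ c) :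
    ∫⁻ y, h y ∂n ≤ c := by
  have hint : ∫⁻ y, h y ∂n ≠ ∞ := by
    refine ((lintegral_mono fun y => ENNReal.coe_le_coe.2 (hM y)).trans_lt ?_).ne
    rw [lintegral_const]
    finiteness
  refine ENNReal.le_of_forall_pos_le_add fun ε hε hc' => ?_
  have hε' : (ε : ℝ≥0∞) ≠ 0 := by exact_mod_cast hε.ne'
  have hε3 : (ε : ℝ≥0∞) / 3 ≠ 0 := by simp [hε']
  -- Vitali-Carathéodory: an upper semicontinuous minorant `g` makes a Dini argument on a compact
  -- set possible. The three thirds of `ε` pay for `g`, for the uniform error `δ`, and for the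
  -- complement of `L`.
  obtain ⟨g, hgh, hg, hgint⟩ := exists_upperSemicontinuous_le_lintegral_le (μ := n) h hint hε3
  obtain ⟨δ, hδ, hδn⟩ : ∃ δ : ℝ≥0, 0 < δ ∧ (δ : ℝ≥0∞) * n univ ≤ ε / 3 := by
    obtain ⟨δ, hδ, hlt⟩ := ENNReal.exists_nnreal_pos_mul_lt (measure_ne_top n univ) hε3
    exact ⟨δ, hδ, hlt.le⟩
  obtain ⟨η, hη, hηM⟩ : ∃ η : ℝ≥0, 0 < η ∧ (η : ℝ≥0∞) * M ≤ ε / 3 := by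
    obtain ⟨δ, hδ, hlt⟩ := ENNReal.exists_nnreal_pos_mul_lt (ENNReal.coe_ne_top (r := M)) hε3
    exact ⟨δ, hδ, hlt.le⟩
  obtain ⟨L, -, hL, hLn⟩ := (MeasurableSet.univ (α := Y)).exists_isCompact_sdiff_lt (μ := n)
    (measure_ne_top n univ) (ε := η) (by exact_mod_cast hη.ne')
  rw [← compl_eq_univ_sdiff] at hLn
  obtain ⟨i, hi⟩ : ∃ i, ∀ y ∈ L, (g y : ℝ≥0∞) ≤ G i y + δ := by
    have key : ∀ y, ∃ i, ∃ U ∈ 𝓝 y, ∀ z ∈ U, (g z : ℝ≥0∞) ≤ G i z + δ := by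
      intro y
      -- Where `g y = 0` there is no `a < g y` in `ℝ≥0`; there `g < δ` nearby and any index serves.
      rcases eq_or_ne (g y) 0 with h0 | h0
      · refine ⟨Classical.arbitrary ι, _, hg y δ (h0.trans_lt hδ), fun z hz => ?_⟩
        exact (ENNReal.coe_le_coe.2 (le_of_lt hz)).trans le_add_self
      obtain ⟨a, ha, hay⟩ : ∃ a, a < g y ∧ g y < a + δ := by
        refine ⟨g y - δ / 2, tsub_lt_self (pos_iff_ne_zero.2 h0) (half_pos hδ), ?_⟩
        calc g y ≤ g y - δ / 2 + δ / 2 := le_tsub_add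
          _ < _ := by gcongr; exact NNReal.half_lt_self hδ.ne'
      obtain ⟨i, hi⟩ : ∃ i, (a : ℝ≥0∞) < G i y := lt_iSup_iff.1
        ((ENNReal.coe_lt_coe.2 (ha.trans_le (hgh y))).trans_le (hh y))
      refine ⟨i, _, inter_mem (hg y _ hay) (hG i y _ hi), fun z hz => ?_⟩
      calc (g z : ℝ≥0∞) ≤ ((a + δ : ℝ≥0) : ℝ≥0∞) := ENNReal.coe_le_coe.2 (le_of_lt hz.1)
        _ = a + δ := by push_cast; rfl
        _ ≤ _ := by gcongr; exact le_of_lt hz.2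
    choose i U hU hgU using key
    obtain ⟨t, -, ht⟩ := hL.elim_nhds_subcover U fun y _ => hU y
    classical
    obtain ⟨j, hj⟩ := hdir.finset_le (t.image i)
    refine ⟨j, fun y hy => ?_⟩
    have hy := ht hy
    simp only [mem_iUnion] at hy
    obtain ⟨z, hz, hy⟩ := hy
    exact (hgU z y hy).trans (by gcongr; exact hj _ (Finset.mem_image_of_mem _ hz) y)
  calc ∫⁻ y, h y ∂n ≤ ∫⁻ y, g y ∂n + ε / 3 := hgint
    _ = ∫⁻ y in L, g y ∂n + ∫⁻ y in Lᶜ, g y ∂n + ε / 3 := by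
        rw [lintegral_add_compl _ hL.measurableSet]
    _ ≤ (∫⁻ y in L, (G i y + δ) ∂n) + ∫⁻ y in Lᶜ, M ∂n + ε / 3 := by
        refine add_le_add (add_le_add (setLIntegral_mono' hL.measurableSet hi)
          (lintegral_mono fun y => ?_)) le_rfl
        exact ENNReal.coe_le_coe.2 ((hgh y).trans (hM y))
    _ ≤ (∫⁻ y, (G i y + δ) ∂n) + M * η + ε / 3 := by
        gcongr
        · exact Measure.restrict_le_self
        · rw [setLIntegral_const]; gcongr
    _ ≤ c + ε / 3 + ε / 3 + ε / 3 := by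
        gcongr
        · rw [lintegral_add_right _ measurable_const, lintegral_const]
          exact add_le_add (hc i) hδn
        · rwa [mul_comm]
    _ = c + ε := by rw [add_assoc, add_assoc, ← add_assoc (_ / _), ENNReal.add_thirds]

/-! ### Convolution of positive measures -/

section PositiveConvolution

variable {S : Type*} [TopologicalSpace S]

/-- Pairs of a compact set and a continuous function with compact support in `U` and values in
`[0, 1]`. -/
def CutoffPair (U : Set S) : Type _ :=
  {p : Set S × (S → ℝ) // IsCompact p.1 ∧ Continuous p.2 ∧ HasCompactSupport p.2 ∧
    tsupport p.2 ⊆ U ∧ ∀ x, p.2 x ∈ Icc (0 : ℝ) 1}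

variable {U : Set S}

theorem CutoffPair.compact (p : CutoffPair U) : IsCompact p.1.1 := p.2.1
theorem CutoffPair.continuous (p : CutoffPair U) : Continuous p.1.2 := p.2.2.1
theorem CutoffPair.hasCompactSupport (p : CutoffPair U) : HasCompactSupport p.1.2 := p.2.2.2.1
theorem CutoffPair.tsupport_subset (p : CutoffPair U) : tsupport p.1.2 ⊆ U := p.2.2.2.2.1
theorem CutoffPair.mem_Icc (p : CutoffPair U) (x : S) : p.1.2 x ∈ Icc (0 : ℝ) 1 := p.2.2.2.2.2 x

instance : Nonempty (CutoffPair U) :=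
  ⟨⟨(∅, 0), isCompact_empty, continuous_zero, HasCompactSupport.zero, by simp [tsupport], by simp⟩⟩

theorem CutoffPair.exists_ge (p q : CutoffPair U) :
    ∃ r : CutoffPair U, p.1 ≤ r.1 ∧ q.1 ≤ r.1 := by
  have hsub : tsupport (p.1.2 ⊔ q.1.2) ⊆ tsupport p.1.2 ∪ tsupport q.1.2 := by
    rw [tsupport, tsupport, tsupport, ← closure_union]
    exact closure_mono (Function.support_sup _ _)
  refine ⟨⟨(p.1.1 ∪ q.1.1, p.1.2 ⊔ q.1.2), p.compact.union q.compact,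
    p.continuous.sup q.continuous, ?_, hsub.trans (union_subset p.tsupport_subset
      q.tsupport_subset), fun x => ?_⟩, ?_, ?_⟩
  · exact IsCompact.of_isClosed_subset (p.hasCompactSupport.union q.hasCompactSupport)
      (isClosed_tsupport _) hsub
  · exact ⟨(p.mem_Icc x).1.trans le_sup_left, sup_le (p.mem_Icc x).2 (q.mem_Icc x).2⟩
  · exact ⟨subset_union_left, le_sup_left⟩
  · exact ⟨subset_union_right, le_sup_right⟩

variable [CommMonoid S] [MeasurableSpace S] (m : Measure S)

/-- The translate integral `y ↦ ∫_K f(xy) dm(x)` attached to a cutoff pair `(K, f)`. -/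
noncomputable def CutoffPair.average (p : CutoffPair U) (y : S) : ℝ≥0∞ :=
  ∫⁻ x in p.1.1, ENNReal.ofReal (p.1.2 (x * y)) ∂m

theorem CutoffPair.average_mono {p q : CutoffPair U} (h : p.1 ≤ q.1) :
    p.average m ≤ q.average m := fun y =>
  lintegral_mono' (Measure.restrict_mono h.1 le_rfl)
    fun x => ENNReal.ofReal_le_ofReal (h.2 (x * y))

theorem CutoffPair.directed_average :
    Directed (· ≤ ·) fun p : CutoffPair U => p.average m := fun p q => by
  obtain ⟨r, hp, hq⟩ := p.exists_ge q
  exact ⟨r, average_mono m hp, average_mono m hq⟩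

variable [SeparatelyContinuousMul S] [BorelSpace S]

theorem CutoffPair.average_le (p : CutoffPair U) (y : S) :
    p.average m y ≤ m {x | x * y ∈ tsupport p.1.2} := by
  have hm : MeasurableSet {x | x * y ∈ tsupport p.1.2} :=
    ((isClosed_tsupport _).preimage (continuous_mul_const y)).measurableSet
  rw [← lintegral_indicator_one hm]
  refine lintegral_mono' Measure.restrict_le_self fun x => ?_
  by_cases hx : x * y ∈ tsupport p.1.2
  · rw [indicator_of_mem (by exact hx)]
    exact ENNReal.ofReal_le_one.2 (p.mem_Icc _).2
  · rw [image_eq_zero_of_notMem_tsupport hx]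
    simp

variable [T2Space S] [LocallyCompactSpace S]

theorem CutoffPair.continuous_average [IsFiniteMeasure m] (p : CutoffPair U) :
    Continuous (p.average m) := by
  have h := continuous_setIntegral_of_separately_continuous (F := fun x y => p.1.2 (x * y))
    (fun y => p.continuous.comp (continuous_mul_const y))
    (fun x => p.continuous.comp (continuous_const_mul x)) (C := 1)
    (fun x y => abs_le.2 ⟨by linarith [(p.mem_Icc (x * y)).1], (p.mem_Icc (x * y)).2⟩) m
    p.compact p.compact.measurableSet
  refine (ENNReal.continuous_ofReal.comp h).congr fun y => ?_
  rw [Function.comp, ofReal_integral_eq_lintegral_ofReal]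
  · rfl
  · refine Integrable.of_bound (C := 1)
      (p.continuous.comp (continuous_mul_const y)).measurable.aestronglyMeasurable
      (ae_of_all _ fun x => ?_)
    rw [Real.norm_of_nonneg (p.mem_Icc _).1]
    exact (p.mem_Icc _).2
  · exact ae_of_all _ fun x => (p.mem_Icc _).1

/-- Inner regularity of `m` gives a compact `K` inside the open set on the left, and Urysohn a
cutoff in `U` equal to `1` on `K * y`. -/
theorem measure_mul_mem_eq_iSup [m.Regular] (hU : IsOpen U) (y : S) :
    m {x | x * y ∈ U} = ⨆ p : CutoffPair U, p.average m y := by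
  refine le_antisymm (le_of_forall_lt fun a ha => ?_)
    (iSup_le fun p => (p.average_le m y).trans (measure_mono fun x hx => p.tsupport_subset hx))
  obtain ⟨K, hKU, hK, haK⟩ := (hU.preimage (continuous_mul_const y)).exists_lt_isCompact ha
  obtain ⟨f, hfK, hf, hfU, hf01⟩ := exists_continuousMap_one_of_isCompact_subset_isOpen
    (hK.image (continuous_mul_const y)) hU (image_subset_iff.2 hKU)
  refine lt_iSup_iff.2 ⟨⟨(K, f), hK, f.continuous, hf, hfU, hf01⟩, haK.trans_le ?_⟩
  change m K ≤ ∫⁻ x in K, ENNReal.ofReal (f (x * y)) ∂m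
  rw [← setLIntegral_one]
  refine setLIntegral_mono' hK.measurableSet fun x hx => ?_
  simp [hfK (mem_image_of_mem _ hx)]

theorem lowerSemicontinuous_measure_mul_mem [IsFiniteMeasure m] [m.Regular] (hU : IsOpen U) :
    LowerSemicontinuous fun y => m {x | x * y ∈ U} := by
  simp_rw [measure_mul_mem_eq_iSup m hU]
  exact lowerSemicontinuous_iSup fun p => (p.continuous_average m).lowerSemicontinuous

/-- Open sets form a generating `π`-system, and on them lower semicontinuity gives measurability. So
the translates of `m` form a kernel. -/
theorem measurable_map_mul [IsFiniteMeasure m] [m.Regular] :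
    Measurable fun y : S => m.map (· * y) := by
  have hmeas : ∀ U : Set S, IsOpen U → Measurable fun y : S => m.map (· * y) U := fun U hU => by
    simp_rw [Measure.map_apply (continuous_mul_const _).measurable hU.measurableSet]
    exact (lowerSemicontinuous_measure_mul_mem m hU).measurable
  exact Measurable.measure_of_isPiSystem (BorelSpace.measurable_eq) isPiSystem_isOpen hmeas
    (hmeas _ isOpen_univ)

theorem measurable_measure_mul_mem [IsFiniteMeasure m] [m.Regular] {E : Set S}
    (hE : MeasurableSet E) : Measurable fun y => m {x | x * y ∈ E} := by
  have h := (Measure.measurable_coe hE).comp (measurable_map_mul m)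
  simp only [Function.comp_def, Measure.map_apply (continuous_mul_const _).measurable hE] at h
  exact h

/-- The convolution of two positive measures, `E ↦ ∫ m {x | xy ∈ E} dn(y)`. -/
noncomputable def posConv (m n : Measure S) : Measure S := n.bind fun y => m.map (· * y)

variable (n : Measure S) [IsFiniteMeasure m] [m.Regular]

theorem posConv_apply {E : Set S} (hE : MeasurableSet E) :
    posConv m n E = ∫⁻ y, m {x | x * y ∈ E} ∂n := by
  rw [posConv, Measure.bind_apply hE (measurable_map_mul m).aemeasurable]
  refine lintegral_congr fun y => ?_
  rw [Measure.map_apply (continuous_mul_const _).measurable hE]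
  rfl

theorem posConv_univ : posConv m n univ = m univ * n univ := by
  simp [posConv_apply m n MeasurableSet.univ]

instance [IsFiniteMeasure n] : IsFiniteMeasure (posConv m n) :=
  ⟨by rw [posConv_univ]; finiteness⟩

/-- Semicharacters are only a.e. measurable for each measure, so Borel `f` would not suffice. For
`n`-almost every `y` the function is a.e. measurable for the translate of `m` by `y`. -/
theorem lintegral_posConv {f : S → ℝ≥0∞} (hf : AEMeasurable f (posConv m n)) :
    ∫⁻ z, f z ∂posConv m n = ∫⁻ y, ∫⁻ x, f (x * y) ∂m ∂n := by
  rw [posConv, Measure.lintegral_bind (measurable_map_mul m).aemeasurable hf]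
  refine lintegral_congr_ae ?_
  filter_upwards [AEMeasurable.ae_of_bind (measurable_map_mul m).aemeasurable hf] with y hy
  exact lintegral_map' hy (continuous_mul_const _).aemeasurable

/-- By `τ`-additivity some cutoff pair already has integral above `r`; the compact support of its
function then carries more mass than `r`. For a finite measure, inner regularity on open sets
implies outer regularity. -/
instance [IsFiniteMeasure n] [n.Regular] : (posConv m n).Regular := by
  have hU : (posConv m n).InnerRegularWRT IsCompact IsOpen := by
    intro U hU r hr
    rw [posConv_apply m n hU.measurableSet] at hr
    obtain ⟨p, hp⟩ : ∃ p : CutoffPair U, r < ∫⁻ y, p.average m y ∂n := by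
      by_contra! hcon
      refine hr.not_ge ?_
      have := lintegral_le_of_directed_lowerSemicontinuous n
        (fun p : CutoffPair U => (p.continuous_average m).lowerSemicontinuous)
        (CutoffPair.directed_average m) (h := fun y => (m {x | x * y ∈ U}).toNNReal)
        (M := (m univ).toNNReal)
        (fun y => ENNReal.toNNReal_mono (measure_ne_top _ _) (measure_mono (subset_univ _)))
        (fun y => by
          rw [ENNReal.coe_toNNReal (measure_ne_top _ _), measure_mul_mem_eq_iSup m hU]) hcon
      simpa only [ENNReal.coe_toNNReal (measure_ne_top _ _)] using this
    refine ⟨tsupport p.1.2, p.tsupport_subset, p.hasCompactSupport, hp.trans_le ?_⟩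
    rw [posConv_apply m n (isClosed_tsupport _).measurableSet]
    exact lintegral_mono (p.average_le m)
  have : (posConv m n).WeaklyRegular := Measure.InnerRegularWRT.weaklyRegular_of_finite _
    fun U hUo r hr => by
      obtain ⟨K, hKU, hK, hr⟩ := hU hUo r hr
      exact ⟨K, hKU, hK.isClosed, hr⟩
  exact ⟨hU⟩

/-- Multiplication by a multiplicative density is a homomorphism for the convolution. -/
theorem posConv_withDensity [SFinite n] {f : S → ℝ≥0∞} (hmul : ∀ a b, f (a * b) = f a * f b)
    (hfin : ∀ a, f a ≠ ∞)
    (hn : AEMeasurable f n) (hmn : AEMeasurable f (posConv m n))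
    [IsFiniteMeasure (m.withDensity f)] [(m.withDensity f).Regular] :
    (posConv m n).withDensity f = posConv (m.withDensity f) (n.withDensity f) := by
  ext E hE
  have hEy : ∀ y, MeasurableSet {x : S | x * y ∈ E} := fun y =>
    (continuous_mul_const y).measurable hE
  rw [withDensity_apply _ hE, posConv_apply _ _ hE, ← lintegral_indicator hE,
    lintegral_posConv m n (hmn.indicator hE),
    lintegral_withDensity_eq_lintegral_mul₀ hn]
  · refine lintegral_congr fun y => ?_
    simp only [Pi.mul_apply]
    -- Finiteness of `f y` lets it enter the inner integral without any measurability of the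
    -- integrand.
    rw [withDensity_apply _ (hEy y), ← lintegral_const_mul' _ _ (hfin y),
      ← lintegral_indicator (hEy y)]
    refine lintegral_congr fun x => ?_
    by_cases hx : x * y ∈ E
    · rw [indicator_of_mem hx, indicator_of_mem (by exact hx), hmul, mul_comm]
    · rw [indicator_of_notMem hx, indicator_of_notMem (by exact hx)]
  · exact (measurable_measure_mul_mem (m.withDensity f) hE).aemeasurable

end PositiveConvolution

/-! ### Linear maps and complex scalars in vector-measure integrals -/

section VectorIntegral

variable {X E F G G' : Type*} {mX : MeasurableSpace X}
  [NormedAddCommGroup E] [NormedSpace ℝ E] [NormedAddCommGroup F] [NormedSpace ℝ F]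
  [NormedAddCommGroup G] [NormedSpace ℝ G] [NormedAddCommGroup G'] [NormedSpace ℝ G']

theorem _root_.MeasureTheory.DominatedFinMeasAdditive.clm_comp {μ : Measure X}
    {T : Set X → E →L[ℝ] G} {C : ℝ} (hT : DominatedFinMeasAdditive μ T C) (L : G →L[ℝ] G') :
    DominatedFinMeasAdditive μ (fun s => L ∘L T s) (‖L‖ * C) := by
  refine ⟨fun s t hs ht hμs hμt hst => ?_, fun s hs hμs => ?_⟩
  · simp only [hT.1 s t hs ht hμs hμt hst, ContinuousLinearMap.comp_add]
  · refine (L.opNorm_comp_le _).trans ?_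
    rw [mul_assoc]
    exact mul_le_mul_of_nonneg_left (hT.2 s hs hμs) (norm_nonneg _)

/-- Both sides are additive and continuous in `f` and agree on indicators. It serves for complex
scalars and for the inclusion of `ℝ` in `ℂ`. -/
theorem setToFun_clm_comp [CompleteSpace G] [CompleteSpace G'] {μ : Measure X}
    {T : Set X → E →L[ℝ] G} {C C' : ℝ}
    (hT : DominatedFinMeasAdditive μ T C) (L : G →L[ℝ] G')
    (hT' : DominatedFinMeasAdditive μ (fun s => L ∘L T s) C') {f : X → E}
    (hf : Integrable f μ) :
    setToFun μ (fun s => L ∘L T s) hT' f = L (setToFun μ T hT f) := by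
  revert f
  refine Integrable.induction _ (fun c s hs hμs => ?_) (fun f g _ hf hg hPf hPg => ?_) ?_
    (fun f g hfg hf hPf => ?_)
  · rw [setToFun_indicator_const _ hs hμs.ne, setToFun_indicator_const _ hs hμs.ne]
    rfl
  · rw [setToFun_add _ hf hg, setToFun_add _ hf hg, map_add, hPf, hPg]
  · exact isClosed_eq (continuous_setToFun hT') (L.continuous.comp (continuous_setToFun hT))
  · rw [← setToFun_congr_ae _ hfg, ← setToFun_congr_ae _ hfg, hPf]

/-- Complex scalars pull out of the measure in the integral with respect to a vector measure. -/
theorem vectorIntegral_smul_measure [NormedSpace ℂ F] [NormedSpace ℂ G] [CompleteSpace G]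
    {B : E →L[ℝ] F →L[ℝ] G} (hB : ∀ x (c : ℂ) v, B x (c • v) = c • B x v)
    (μ : VectorMeasure X F) (c : ℂ) {f : X → E} (hf : μ.Integrable f) :
    (c • μ).integral f B = c • μ.integral f B := by
  have hT := dominatedFinMeasAdditive_cbmApplyMeasure μ B
  let L : G →L[ℝ] G := c • ContinuousLinearMap.id ℝ G
  have hL : (fun s => L ∘L μ.transpose B s) = (c • μ).transpose B := by
    funext s
    exact ContinuousLinearMap.ext fun x => (hB x c (μ s)).symm
  have hT' := hT.clm_comp L
  have h1 := setToFun_clm_comp hT L hT' hf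
  -- The two integrals are built over different dominating measures; these differ by the finite
  -- factor `‖c‖₊`, which does not affect the value.
  have h2 := setToFun_congr_measure_of_integrable (μ := μ.variation) (μ' := (c • μ).variation)
    (‖c‖₊ : ℝ≥0∞) ENNReal.coe_ne_top
    (by rw [VectorMeasure.variation_smul]; exact le_rfl) (hL ▸ hT')
    (dominatedFinMeasAdditive_cbmApplyMeasure (c • μ) B) f hf
  rw [VectorMeasure.integral, VectorMeasure.integral, ← h2]
  simp only [hL] at h1
  exact h1

end VectorIntegral

/-! ### Positive measures as elements of `M S` -/

section OfMeasure

/-- Variation depends only on the norms of the values, which the inclusion of `ℝ` in `ℂ` preserves.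
-/
theorem variation_toComplexMeasure {S : Type*} [MeasurableSpace S] (m : Measure S)
    [IsFiniteMeasure m] : (m.toSignedMeasure.toComplexMeasure 0).variation = m := by
  conv_rhs => rw [← Measure.variation_toSignedMeasure (μ := m)]
  have h : (fun s => ‖(m.toSignedMeasure.toComplexMeasure 0) s‖ₑ) =
      fun s => ‖m.toSignedMeasure s‖ₑ := by
    funext s
    rw [SignedMeasure.toComplexMeasure_apply, zero_apply,
      ← Complex.ofReal_def, ← ofReal_norm, ← ofReal_norm, Complex.norm_real]
  simp only [VectorMeasure.variation, h]

variable {S : Type*} [TopologicalSpace S] [T2Space S] [MeasurableSpace S] [BorelSpace S]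

/-- A finite regular positive measure as an element of `M(S)`. -/
noncomputable def ofMeasure (m : Measure S) [IsFiniteMeasure m] [m.Regular] : M S :=
  ⟨m.toSignedMeasure.toComplexMeasure 0, by
    change IsFiniteMeasure (m.toSignedMeasure.toComplexMeasure 0).variation ∧
      (m.toSignedMeasure.toComplexMeasure 0).variation.Regular
    rw [variation_toComplexMeasure]
    exact ⟨inferInstance, inferInstance⟩⟩

variable (m : Measure S) [IsFiniteMeasure m] [m.Regular]

@[simp] theorem variation_ofMeasure : (ofMeasure m : ComplexMeasure S).variation = m :=
  variation_toComplexMeasure m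

theorem norm_ofMeasure : ‖ofMeasure m‖ = m.real univ := by
  rw [norm_def, variation_ofMeasure]

theorem ofMeasure_apply {E : Set S} (hE : MeasurableSet E) :
    (ofMeasure m : ComplexMeasure S) E = m.real E := by
  change (m.toSignedMeasure.toComplexMeasure 0) E = _
  rw [SignedMeasure.toComplexMeasure_apply, Measure.toSignedMeasure_apply_measurable hE]
  rfl

theorem integral_ofMeasure (f : S → ℂ) : integral f (ofMeasure m) = ∫ x, f x ∂m := by
  rw [integral, VectorMeasure.integral, MeasureTheory.integral_eq_setToFun]
  simp only [variation_ofMeasure]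
  refine setToFun_congr_left' _ _ (fun s hs _ => ?_) f
  ext x
  simp [VectorMeasure.transpose, ofMeasure_apply m hs, weightedSMul, mul_comm]

theorem integral_lsmul_ofMeasure {f : S → ℝ} (hf : Integrable f m) :
    (ofMeasure m : ComplexMeasure S).integral f (ContinuousLinearMap.lsmul ℝ ℝ) =
      ((∫ x, f x ∂m : ℝ) : ℂ) := by
  rw [VectorMeasure.integral, MeasureTheory.integral_eq_setToFun]
  simp only [variation_ofMeasure]
  rw [← Complex.ofRealCLM_apply, ← setToFun_clm_comp _ _
    ((dominatedFinMeasAdditive_weightedSMul m).clm_comp _) hf]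
  refine setToFun_congr_left' _ _ (fun s hs _ => ?_) f
  refine ContinuousLinearMap.ext fun x => ?_
  change (x : ℝ) • (ofMeasure m : ComplexMeasure S) s = ((weightedSMul m s x : ℝ) : ℂ)
  simp [ofMeasure_apply m hs, weightedSMul, mul_comm]

end OfMeasure

/-! ### Decomposition and uniqueness in `M S` -/

section MeasureSpace

variable {S : Type*} [TopologicalSpace S] [T2Space S] [MeasurableSpace S] [BorelSpace S]

theorem norm_apply_le (μ : M S) (E : Set S) : ‖(μ : ComplexMeasure S) E‖ ≤ ‖μ‖ :=
  (VectorMeasure.norm_measure_le_variation).trans (measureReal_mono (subset_univ E))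

theorem integral_add_measure {f : S → ℂ} {μ ν : M S}
    (hμ : Integrable f (μ : ComplexMeasure S).variation)
    (hν : Integrable f (ν : ComplexMeasure S).variation) :
    integral f (μ + ν) = integral f μ + integral f ν :=
  VectorMeasure.integral_add_vectorMeasure hμ hν

theorem integral_smul_measure {f : S → ℂ} {μ : M S} (c : ℂ)
    (hμ : Integrable f (μ : ComplexMeasure S).variation) :
    integral f (c • μ) = c * integral f μ :=
  vectorIntegral_smul_measure (fun x c v => mul_left_comm x c v) _ c hμ

theorem integral_const_mul_fun (c : ℂ) (f : S → ℂ) (μ : M S) :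
    integral (fun x => c * f x) μ = c * integral f μ :=
  setToFun_smul (𝕜 := ℂ) _ (fun c _ x => mul_assoc c x _) c f

theorem norm_integral_le {f : S → ℂ} {C : ℝ} (hf : ∀ x, ‖f x‖ ≤ C) (μ : M S) :
    ‖integral f μ‖ ≤ C * ‖μ‖ := by
  have h := VectorMeasure.norm_integral_le_of_norm_le_const (μ := (μ : ComplexMeasure S))
    (B := ContinuousLinearMap.mul ℝ ℂ) (ae_of_all _ hf)
  rwa [ContinuousLinearMap.opNorm_mul, mul_one] at h

theorem integrable_of_norm_le {f : S → ℂ} (hf : Measurable f) {C : ℝ} (hC : ∀ x, ‖f x‖ ≤ C)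
    (μ : M S) : Integrable f (μ : ComplexMeasure S).variation :=
  Integrable.of_bound hf.aestronglyMeasurable C (ae_of_all _ hC)

theorem integrable_boundedContinuous (f : S →ᵇ ℂ) (μ : M S) :
    Integrable f (μ : ComplexMeasure S).variation :=
  integrable_of_norm_le f.continuous.measurable f.norm_coe_le_norm μ

/-- Jordan decomposition, applied below to real and imaginary parts; both parts lie below `|μ|` and
inherit its regularity. -/
theorem exists_sub_ofMeasure {μ : M S} (s : SignedMeasure S)
    (hs : ∀ E, ‖s E‖ ≤ ‖(μ : ComplexMeasure S) E‖) :
    ∃ (p q : Measure S) (_ : IsFiniteMeasure p) (_ : p.Regular) (_ : IsFiniteMeasure q)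
      (_ : q.Regular), p ≤ (μ : ComplexMeasure S).variation ∧
      q ≤ (μ : ComplexMeasure S).variation ∧ ∀ E, MeasurableSet E → s E = p.real E - q.real E := by
  have hv : s.totalVariation ≤ (μ : ComplexMeasure S).variation := by
    rw [SignedMeasure.totalVariation_eq_variation]
    refine VectorMeasure.variation_le_of_forall_enorm_le fun E _ => ?_
    refine le_trans ?_ (VectorMeasure.enorm_measure_le_variation _ E)
    rw [← ofReal_norm, ← ofReal_norm]
    exact ENNReal.ofReal_le_ofReal (hs E)
  have hp : s.toJordanDecomposition.posPart ≤ (μ : ComplexMeasure S).variation :=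
    le_trans (Measure.le_add_right le_rfl) hv
  have hq : s.toJordanDecomposition.negPart ≤ (μ : ComplexMeasure S).variation :=
    le_trans (Measure.le_add_left le_rfl) hv
  exact ⟨_, _, inferInstance, regular_of_le hp, inferInstance, regular_of_le hq, hp, hq,
    fun E hE => s.apply_eq_posPart_real_sub_negPart_real hE⟩

/-- The elements of `M(S)` that come from a positive measure. -/
def IsPositive (μ : M S) : Prop :=
  ∃ (m : Measure S) (_ : IsFiniteMeasure m) (_ : m.Regular), μ = ofMeasure m

theorem norm_ofMeasure_le {m : Measure S} [IsFiniteMeasure m] [m.Regular] {μ : M S}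
    (h : m ≤ (μ : ComplexMeasure S).variation) : ‖ofMeasure m‖ ≤ ‖μ‖ := by
  rw [norm_ofMeasure, norm_def]
  exact ENNReal.toReal_mono (measure_ne_top _ _) (h _)

/-- Every element of `M(S)` is a combination of four positive measures of no larger norm. -/
theorem exists_positive_decomposition (μ : M S) : ∃ a b c d : M S,
    (IsPositive a ∧ ‖a‖ ≤ ‖μ‖) ∧ (IsPositive b ∧ ‖b‖ ≤ ‖μ‖) ∧ (IsPositive c ∧ ‖c‖ ≤ ‖μ‖) ∧
      (IsPositive d ∧ ‖d‖ ≤ ‖μ‖) ∧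
      μ = (a + (-1 : ℂ) • b) + (Complex.I • c + (-Complex.I) • d) := by
  obtain ⟨a, b, _, _, _, _, ha, hb, hab⟩ := exists_sub_ofMeasure (μ := μ)
    (ComplexMeasure.re (μ : ComplexMeasure S)) fun E => Complex.abs_re_le_norm _
  obtain ⟨c, d, _, _, _, _, hc, hd, hcd⟩ := exists_sub_ofMeasure (μ := μ)
    (ComplexMeasure.im (μ : ComplexMeasure S)) fun E => Complex.abs_im_le_norm _
  refine ⟨ofMeasure a, ofMeasure b, ofMeasure c, ofMeasure d,
    ⟨⟨a, ‹_›, ‹_›, rfl⟩, norm_ofMeasure_le ha⟩, ⟨⟨b, ‹_›, ‹_›, rfl⟩, norm_ofMeasure_le hb⟩,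
    ⟨⟨c, ‹_›, ‹_›, rfl⟩, norm_ofMeasure_le hc⟩, ⟨⟨d, ‹_›, ‹_›, rfl⟩, norm_ofMeasure_le hd⟩, ?_⟩
  refine Subtype.ext (VectorMeasure.ext fun E hE => ?_)
  have h1 : ((μ : ComplexMeasure S) E).re = a.real E - b.real E := hab E hE
  have h2 : ((μ : ComplexMeasure S) E).im = c.real E - d.real E := hcd E hE
  change (μ : ComplexMeasure S) E = ((ofMeasure a : ComplexMeasure S) E +
    (-1 : ℂ) * (ofMeasure b : ComplexMeasure S) E) +
    (Complex.I * (ofMeasure c : ComplexMeasure S) E +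
      (-Complex.I) * (ofMeasure d : ComplexMeasure S) E)
  simp only [ofMeasure_apply _ hE]
  apply Complex.ext <;> simp [h1, h2, sub_eq_add_neg]

/-- Reduces statements linear in a measure, such as bilinear identities for `conv`, to positive
measures. -/
theorem M_induction {P : M S → Prop} (hpos : ∀ (m : Measure S) [IsFiniteMeasure m] [m.Regular],
    P (ofMeasure m)) (hadd : ∀ μ ν, P μ → P ν → P (μ + ν))
    (hsmul : ∀ (c : ℂ) μ, P μ → P (c • μ)) (μ : M S) : P μ := by
  have hpos' : ∀ a, IsPositive a → P a := fun a ⟨m, _, _, h⟩ => h ▸ hpos m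
  obtain ⟨a, b, c, d, ⟨ha, -⟩, ⟨hb, -⟩, ⟨hc, -⟩, ⟨hd, -⟩, h⟩ := exists_positive_decomposition μ
  rw [h]
  exact hadd _ _ (hadd _ _ (hpos' _ ha) (hsmul _ _ (hpos' _ hb)))
    (hadd _ _ (hsmul _ _ (hpos' _ hc)) (hsmul _ _ (hpos' _ hd)))

/-- On a locally compact space the elements of `M(S)` are determined by the integrals of bounded
continuous functions. -/
theorem eq_of_forall_integral_eq [LocallyCompactSpace S] {κ κ' : M S}
    (h : ∀ f : S →ᵇ ℂ, integral f κ = integral f κ') : κ = κ' := by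
  rw [← sub_eq_zero]
  set δ := κ - κ' with hδ
  have hzero : ∀ f : S →ᵇ ℂ, integral f δ = 0 := fun f => by
    have : δ = κ + (-1 : ℂ) • κ' := by rw [hδ, neg_one_smul, sub_eq_add_neg]
    rw [this, integral_add_measure (integrable_boundedContinuous f _)
      (integrable_boundedContinuous f _), integral_smul_measure _
      (integrable_boundedContinuous f _), h f]
    ring
  refine Subtype.ext (VectorMeasure.ext fun E hE => ?_)
  change (δ : ComplexMeasure S) E = 0
  rw [← enorm_eq_zero, ← nonpos_iff_eq_zero]
  refine ENNReal.le_of_forall_pos_le_add fun ε hε _ => ?_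
  have hε2 : (ε : ℝ≥0∞) / 2 ≠ 0 := by simpa using hε.ne'
  set v := (δ : ComplexMeasure S).variation
  -- A Urysohn function for `K ⊆ U` differs from the indicator of `E` only on `E \ K` and `U \ K`,
  -- and there by at most `1`; each set has variation below `ε / 2`.
  obtain ⟨K, hKE, hK, hvK⟩ := hE.exists_isCompact_sdiff_lt (measure_ne_top v E) hε2
  obtain ⟨U, hKU, hU, -, hvU⟩ := hK.measurableSet.exists_isOpen_sdiff_lt (measure_ne_top v K) hε2
  obtain ⟨g, hgK, -, hgU, hg01⟩ := exists_continuousMap_one_of_isCompact_subset_isOpen hK hU hKU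
  have hgn : ∀ x, ‖(g x : ℂ)‖ ≤ 1 := fun x => by
    rw [Complex.norm_real, Real.norm_of_nonneg (hg01 x).1]
    exact (hg01 x).2
  let f : S →ᵇ ℂ := BoundedContinuousFunction.ofNormedAddCommGroup (fun x => (g x : ℂ))
    (Complex.continuous_ofReal.comp g.continuous) 1 hgn
  have hint : Integrable (E.indicator fun _ => (1 : ℂ)) v := (integrable_const 1).indicator hE
  have h1 : (δ : ComplexMeasure S) E = (δ : ComplexMeasure S).integral
      (fun x => E.indicator (fun _ => (1 : ℂ)) x - f x) (ContinuousLinearMap.mul ℝ ℂ) := by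
    rw [VectorMeasure.integral_fun_sub hint (integrable_boundedContinuous f δ),
      VectorMeasure.integral_indicator_const _ hE]
    have : (δ : ComplexMeasure S).integral f (ContinuousLinearMap.mul ℝ ℂ) = 0 := hzero f
    simp [this]
  have hpt : ∀ x, ‖E.indicator (fun _ => (1 : ℂ)) x - f x‖ₑ ≤
      (E \ K).indicator 1 x + (U \ K).indicator 1 x := by
    intro x
    change ‖E.indicator (fun _ => (1 : ℂ)) x - (g x : ℂ)‖ₑ ≤ _
    by_cases hxK : x ∈ K
    · simp [hKE hxK, hgK hxK]
    · by_cases hxU : x ∈ U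
      · have : ‖E.indicator (fun _ => (1 : ℂ)) x - (g x : ℂ)‖ₑ ≤ 1 := by
          rw [← ofReal_norm, ENNReal.ofReal_le_one]
          by_cases hxE : x ∈ E
          · rw [indicator_of_mem hxE, ← Complex.ofReal_one, ← Complex.ofReal_sub,
              Complex.norm_real, Real.norm_of_nonneg (by linarith [(hg01 x).2])]
            linarith [(hg01 x).1]
          · simpa [hxE] using hgn x
        simpa [hxU, hxK] using this.trans le_add_self
      · have hg0 : g x = 0 := image_eq_zero_of_notMem_tsupport fun h => hxU (hgU h)
        by_cases hxE : x ∈ E <;> simp [hxE, hxK, hxU, hg0]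
  rw [h1, zero_add]
  calc _ ≤ ‖ContinuousLinearMap.mul ℝ ℂ‖ₑ * ∫⁻ x, ‖E.indicator (fun _ => (1 : ℂ)) x - f x‖ₑ ∂v :=
        VectorMeasure.enorm_integral_le_lintegral_enorm
    _ ≤ 1 * ∫⁻ x, ((E \ K).indicator 1 x + (U \ K).indicator 1 x) ∂v := by
        gcongr with x
        · rw [← ofReal_norm, ContinuousLinearMap.opNorm_mul, ENNReal.ofReal_one]
        · exact hpt x
    _ = v (E \ K) + v (U \ K) := by
        rw [one_mul, lintegral_add_left (measurable_one.indicator (hE.diff hK.measurableSet)),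
          lintegral_indicator_one (hE.diff hK.measurableSet),
          lintegral_indicator_one (hU.measurableSet.diff hK.measurableSet)]
    _ ≤ ε / 2 + ε / 2 := add_le_add hvK.le hvU.le
    _ = ε := ENNReal.add_halves _

end MeasureSpace

/-! ### Existence, bilinearity and boundedness of convolution -/

section Convolution

variable {S : Type*} [CommMonoid S] [TopologicalSpace S] [T2Space S]
  [SeparatelyContinuousMul S] [MeasurableSpace S] [BorelSpace S]

/-- The bounded continuous function `x ↦ f(xy)`. -/
noncomputable def mulShift (f : S →ᵇ ℂ) (y : S) : S →ᵇ ℂ :=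
  f.compContinuous ⟨(· * y), continuous_mul_const y⟩

theorem integrable_mulShift (f : S →ᵇ ℂ) (y : S) (μ : M S) :
    Integrable (fun x => f (x * y)) (μ : ComplexMeasure S).variation :=
  integrable_boundedContinuous (mulShift f y) μ

theorem integral_map_mul (f : S →ᵇ ℂ) (m : Measure S) (y : S) :
    ∫ x, f x ∂m.map (· * y) = ∫ x, f (x * y) ∂m :=
  integral_map (continuous_mul_const y).aemeasurable
    f.continuous.measurable.aestronglyMeasurable

variable [LocallyCompactSpace S]

theorem stronglyMeasurable_integral_map_mul (f : S →ᵇ ℂ) (m : Measure S) [IsFiniteMeasure m]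
    [m.Regular] : StronglyMeasurable fun y => ∫ x, f x ∂m.map (· * y) :=
  f.continuous.stronglyMeasurable.integral_kernel
    (κ := (⟨fun y => m.map (· * y), measurable_map_mul m⟩ : ProbabilityTheory.Kernel S S))

/-- Makes the outer integral in `IsConv` additive in the inner measure. The positive case comes from
the kernel of translates instead of joint measurability. -/
theorem measurable_integral_mul (f : S →ᵇ ℂ) (μ : M S) :
    Measurable fun y => integral (fun x => f (x * y)) μ := by
  induction μ using M_induction with
  | hpos m =>
    simp_rw [integral_ofMeasure, ← integral_map_mul]
    exact (stronglyMeasurable_integral_map_mul f m).measurable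
  | hadd μ ν hμ hν =>
    simp_rw [integral_add_measure (integrable_mulShift f _ μ) (integrable_mulShift f _ ν)]
    exact hμ.add hν
  | hsmul c μ hμ =>
    simp_rw [integral_smul_measure c (integrable_mulShift f _ μ)]
    exact hμ.const_mul c

theorem integrable_integral_mul (f : S →ᵇ ℂ) (μ ν : M S) :
    Integrable (fun y => integral (fun x => f (x * y)) μ) (ν : ComplexMeasure S).variation :=
  integrable_of_norm_le (measurable_integral_mul f μ)
    (fun y => norm_integral_le (fun x => f.norm_coe_le_norm (x * y)) μ) ν

theorem isConv_ofMeasure (m n : Measure S) [IsFiniteMeasure m] [m.Regular] [IsFiniteMeasure n]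
    [n.Regular] : IsConv (ofMeasure m) (ofMeasure n) (ofMeasure (posConv m n)) := by
  intro f
  simp_rw [integral_ofMeasure, ← integral_map_mul]
  have hf := integrable_boundedContinuous f (ofMeasure (posConv m n))
  rw [variation_ofMeasure] at hf
  -- `posConv m n` is the composition of the constant kernel `n` with the kernel of translates of
  -- `m`.
  exact ProbabilityTheory.Kernel.integral_comp (κ := ProbabilityTheory.Kernel.const Unit n)
    (η := (⟨fun y => m.map (· * y), measurable_map_mul m⟩ : ProbabilityTheory.Kernel S S))
    (a := ()) hf

theorem IsConv.add_left {μ μ' ν κ κ' : M S} (h : IsConv μ ν κ) (h' : IsConv μ' ν κ') :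
    IsConv (μ + μ') ν (κ + κ') := fun f => by
  simp_rw [integral_add_measure (integrable_mulShift f _ μ) (integrable_mulShift f _ μ')]
  rw [integral_add_measure (integrable_boundedContinuous f _) (integrable_boundedContinuous f _),
    h f, h' f]
  exact (VectorMeasure.integral_fun_add (integrable_integral_mul f μ ν)
    (integrable_integral_mul f μ' ν)).symm

theorem IsConv.add_right {μ ν ν' κ κ' : M S} (h : IsConv μ ν κ) (h' : IsConv μ ν' κ') :
    IsConv μ (ν + ν') (κ + κ') := fun f => by
  rw [integral_add_measure (integrable_boundedContinuous f _) (integrable_boundedContinuous f _),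
    h f, h' f, integral_add_measure (integrable_integral_mul f μ ν)
    (integrable_integral_mul f μ ν')]

theorem IsConv.smul_right {μ ν κ : M S} (c : ℂ) (h : IsConv μ ν κ) :
    IsConv μ (c • ν) (c • κ) := fun f => by
  rw [integral_smul_measure c (integrable_boundedContinuous f _), h f,
    integral_smul_measure c (integrable_integral_mul f μ ν)]

theorem IsConv.smul_left {μ ν κ : M S} (c : ℂ) (h : IsConv μ ν κ) :
    IsConv (c • μ) ν (c • κ) := fun f => by
  simp_rw [integral_smul_measure c (integrable_mulShift f _ μ)]
  rw [integral_smul_measure c (integrable_boundedContinuous f _), h f, integral_const_mul_fun]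

/-- On a locally compact semitopological semigroup convolutions exist. -/
theorem exists_isConv (μ ν : M S) : ∃ κ, IsConv μ ν κ := by
  induction μ using M_induction with
  | hpos m =>
    induction ν using M_induction with
    | hpos n => exact ⟨_, isConv_ofMeasure m n⟩
    | hadd ν ν' h h' => exact ⟨_, h.choose_spec.add_right h'.choose_spec⟩
    | hsmul c ν h => exact ⟨_, h.choose_spec.smul_right c⟩
  | hadd μ μ' h h' => exact ⟨_, h.choose_spec.add_left h'.choose_spec⟩
  | hsmul c μ h => exact ⟨_, h.choose_spec.smul_left c⟩

theorem isConv_conv (μ ν : M S) : IsConv μ ν (conv μ ν) := by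
  rw [conv, dif_pos (exists_isConv μ ν)]
  exact (exists_isConv μ ν).choose_spec

/-- Uniqueness makes the choice inside `conv` harmless, so algebraic rules can be checked on
`IsConv`. -/
theorem IsConv.conv_eq {μ ν κ : M S} (h : IsConv μ ν κ) : conv μ ν = κ :=
  eq_of_forall_integral_eq fun f => (isConv_conv μ ν f).trans (h f).symm

theorem conv_ofMeasure (m n : Measure S) [IsFiniteMeasure m] [m.Regular] [IsFiniteMeasure n]
    [n.Regular] : conv (ofMeasure m) (ofMeasure n) = ofMeasure (posConv m n) :=
  (isConv_ofMeasure m n).conv_eq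

theorem conv_add_left (μ μ' ν : M S) : conv (μ + μ') ν = conv μ ν + conv μ' ν :=
  ((isConv_conv μ ν).add_left (isConv_conv μ' ν)).conv_eq

theorem conv_add_right (μ ν ν' : M S) : conv μ (ν + ν') = conv μ ν + conv μ ν' :=
  ((isConv_conv μ ν).add_right (isConv_conv μ ν')).conv_eq

theorem conv_smul_left (c : ℂ) (μ ν : M S) : conv (c • μ) ν = c • conv μ ν :=
  ((isConv_conv μ ν).smul_left c).conv_eq

theorem conv_smul_right (c : ℂ) (μ ν : M S) : conv μ (c • ν) = c • conv μ ν :=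
  ((isConv_conv μ ν).smul_right c).conv_eq

theorem norm_conv_positive_le {μ ν : M S} (hμ : IsPositive μ) (hν : IsPositive ν) :
    ‖conv μ ν‖ ≤ ‖μ‖ * ‖ν‖ := by
  obtain ⟨m, _, _, rfl⟩ := hμ
  obtain ⟨n, _, _, rfl⟩ := hν
  rw [conv_ofMeasure, norm_ofMeasure, norm_ofMeasure, norm_ofMeasure, measureReal_def,
    posConv_univ, ENNReal.toReal_mul]
  rfl

theorem norm_four_le {V : Type*} [SeminormedAddCommGroup V] [NormedSpace ℂ V] {a b c d : V} {r : ℝ}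
    (ha : ‖a‖ ≤ r) (hb : ‖b‖ ≤ r) (hc : ‖c‖ ≤ r) (hd : ‖d‖ ≤ r) :
    ‖(a + (-1 : ℂ) • b) + (Complex.I • c + (-Complex.I) • d)‖ ≤ 4 * r := by
  have h1 : ‖(-1 : ℂ) • b‖ ≤ r := by simpa [norm_smul] using hb
  have h2 : ‖Complex.I • c‖ ≤ r := by simpa [norm_smul] using hc
  have h3 : ‖(-Complex.I) • d‖ ≤ r := by simpa [norm_smul] using hd
  calc _ ≤ (‖a‖ + ‖(-1 : ℂ) • b‖) + (‖Complex.I • c‖ + ‖(-Complex.I) • d‖) :=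
        (norm_add_le _ _).trans (add_le_add (norm_add_le _ _) (norm_add_le _ _))
    _ ≤ 4 * r := by linarith

/-- A crude bound for the norm of a convolution, sufficient for the continuity of characters. -/
theorem norm_conv_le (μ ν : M S) : ‖conv μ ν‖ ≤ 16 * (‖μ‖ * ‖ν‖) := by
  -- Four positive pieces on the right cost a factor `4`, and four on the left another.
  have key : ∀ {a : M S}, IsPositive a → ∀ ν : M S, ‖conv a ν‖ ≤ 4 * (‖a‖ * ‖ν‖) := by
    intro a ha ν
    obtain ⟨p, q, r, s, ⟨hp, hp'⟩, ⟨hq, hq'⟩, ⟨hr, hr'⟩, ⟨hs, hs'⟩, h⟩ :=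
      exists_positive_decomposition ν
    have hle : ∀ {x : M S}, IsPositive x → ‖x‖ ≤ ‖ν‖ → ‖conv a x‖ ≤ ‖a‖ * ‖ν‖ :=
      fun hx hx' => (norm_conv_positive_le ha hx).trans
        (mul_le_mul_of_nonneg_left hx' (norm_nonneg _))
    have := norm_four_le (hle hp hp') (hle hq hq') (hle hr hr') (hle hs hs')
    rwa [← conv_smul_right, ← conv_smul_right, ← conv_smul_right, ← conv_add_right,
      ← conv_add_right, ← conv_add_right, ← h] at this
  obtain ⟨p, q, r, s, ⟨hp, hp'⟩, ⟨hq, hq'⟩, ⟨hr, hr'⟩, ⟨hs, hs'⟩, h⟩ :=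
    exists_positive_decomposition μ
  have hle : ∀ {x : M S}, IsPositive x → ‖x‖ ≤ ‖μ‖ → ‖conv x ν‖ ≤ 4 * (‖μ‖ * ‖ν‖) :=
    fun hx hx' => (key hx ν).trans (by gcongr)
  have := norm_four_le (hle hp hp') (hle hq hq') (hle hr hr') (hle hs hs')
  rw [← conv_smul_left, ← conv_smul_left, ← conv_smul_left, ← conv_add_left,
    ← conv_add_left, ← conv_add_left, ← h] at this
  linarith

end Convolution

/-! ### Multiplication of measures by semicharacters -/

section Density

variable {S : Type*} [TopologicalSpace S] [T2Space S] [MeasurableSpace S] [BorelSpace S]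

theorem variation_dirac (s : S) : (dirac s : ComplexMeasure S).variation = Measure.dirac s := by
  change (VectorMeasure.dirac s (1 : ℂ)).variation = _
  rw [VectorMeasure.variation_dirac, enorm_one, one_smul]

variable [CommMonoid S]

theorem semicharacter_norm_le_one (ρ : SStar S) (s : S) : ‖(ρ : S → ℝ) s‖ ≤ 1 := by
  rw [Real.norm_of_nonneg (ρ.2.1 s).1]
  exact (ρ.2.1 s).2

theorem map_one_of_mem_SStar {ρ : S → ℝ} (hρ : ρ ∈ SStar S) : ρ 1 = 1 := by
  obtain ⟨-, hmul, ⟨s, hs⟩, -⟩ := hρ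
  have h := hmul s 1
  rw [mul_one] at h
  exact (mul_eq_left₀ hs).1 h.symm

theorem semicharacter_aemeasurable (ρ : SStar S) (m : Measure S) [IsFiniteMeasure m] [m.Regular] :
    AEMeasurable (ρ : S → ℝ) m := by
  have h := ρ.2.2.2.2 (ofMeasure m)
  rwa [variation_ofMeasure] at h

theorem semicharacter_integrable (ρ : SStar S) (μ : M S) :
    Integrable (ρ : S → ℝ) (μ : ComplexMeasure S).variation :=
  Integrable.of_bound (ρ.2.2.2.2 μ).aestronglyMeasurable 1 (ae_of_all _ (semicharacter_norm_le_one ρ))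

theorem density_apply (ρ : SStar S) (μ : M S) (E : Set S) :
    (density ρ μ : ComplexMeasure S) E =
      ((μ : ComplexMeasure S).restrict E).integral (ρ : S → ℝ) (ContinuousLinearMap.lsmul ℝ ℝ) :=
  VectorMeasure.withDensity_apply (semicharacter_integrable ρ μ)

theorem density_add (ρ : SStar S) (μ ν : M S) :
    density ρ (μ + ν) = density ρ μ + density ρ ν := by
  refine Subtype.ext (VectorMeasure.ext fun E hE => ?_)
  change _ = (density ρ μ : ComplexMeasure S) E + (density ρ ν : ComplexMeasure S) E
  rw [density_apply, density_apply, density_apply, Submodule.coe_add, VectorMeasure.restrict_add]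
  exact VectorMeasure.integral_add_vectorMeasure (VectorMeasure.Integrable.restrict
    (semicharacter_integrable ρ μ)) (VectorMeasure.Integrable.restrict (semicharacter_integrable ρ ν))

theorem density_smul (ρ : SStar S) (c : ℂ) (μ : M S) :
    density ρ (c • μ) = c • density ρ μ := by
  refine Subtype.ext (VectorMeasure.ext fun E hE => ?_)
  change _ = c • (density ρ μ : ComplexMeasure S) E
  rw [density_apply, density_apply, Submodule.coe_smul, VectorMeasure.restrict_smul]
  exact vectorIntegral_smul_measure (fun x c v => smul_comm x c v) _ c
    (VectorMeasure.Integrable.restrict (semicharacter_integrable ρ μ))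

theorem withDensity_le (ρ : SStar S) (m : Measure S) :
    m.withDensity (fun s => ENNReal.ofReal ((ρ : S → ℝ) s)) ≤ m :=
  (withDensity_mono (ae_of_all _ fun s => ENNReal.ofReal_le_one.2 (ρ.2.1 s).2)).trans_eq
    withDensity_one

theorem density_ofMeasure (ρ : SStar S) (m : Measure S) [IsFiniteMeasure m] [m.Regular]
    [IsFiniteMeasure (m.withDensity fun s => ENNReal.ofReal ((ρ : S → ℝ) s))]
    [(m.withDensity fun s => ENNReal.ofReal ((ρ : S → ℝ) s)).Regular] :
    density ρ (ofMeasure m) =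
      ofMeasure (m.withDensity fun s => ENNReal.ofReal ((ρ : S → ℝ) s)) := by
  refine Subtype.ext (VectorMeasure.ext fun E hE => ?_)
  have : (m.restrict E).Regular := regular_of_le Measure.restrict_le_self
  have hr : (ofMeasure m : ComplexMeasure S).restrict E = ofMeasure (m.restrict E) := by
    refine VectorMeasure.ext fun F hF => ?_
    rw [VectorMeasure.restrict_apply _ hE hF, ofMeasure_apply _ (hF.inter hE),
      ofMeasure_apply _ hF, measureReal_restrict_apply hF]
  have hint := semicharacter_integrable ρ (ofMeasure (m.restrict E))
  rw [variation_ofMeasure] at hint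
  rw [density_apply, hr, integral_lsmul_ofMeasure _ hint, ofMeasure_apply _ hE, measureReal_def,
    withDensity_apply _ hE, integral_eq_lintegral_of_nonneg_ae (ae_of_all _ fun s => (ρ.2.1 s).1)
      hint.aestronglyMeasurable]

theorem density_eq_self {ρ : SStar S} {μ : M S}
    (h : (ρ : S → ℝ) =ᵐ[(μ : ComplexMeasure S).variation] fun _ => 1) : density ρ μ = μ := by
  refine Subtype.ext (VectorMeasure.ext fun E hE => ?_)
  have h' : (ρ : S → ℝ) =ᵐ[((μ : ComplexMeasure S).restrict E).variation] fun _ => 1 :=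
    Measure.absolutelyContinuous_of_le
      (VectorMeasure.variation_restrict_le.trans Measure.restrict_le_self) h
  rw [density_apply, VectorMeasure.integral_congr_ae h', VectorMeasure.integral_const,
    VectorMeasure.restrict_apply _ hE MeasurableSet.univ, univ_inter]
  simp

theorem density_dirac_one (ρ : SStar S) : density ρ (dirac 1) = dirac 1 := by
  refine density_eq_self ?_
  rw [variation_dirac, Filter.EventuallyEq, ae_dirac_eq]
  exact map_one_of_mem_SStar ρ.2

theorem density_indicator_one {ρ : SStar S}
    (hρ : (ρ : S → ℝ) = Set.indicator {1} fun _ => 1) (μ : M S) :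
    density ρ μ = (μ : ComplexMeasure S) {1} • dirac 1 := by
  refine Subtype.ext (VectorMeasure.ext fun E hE => ?_)
  change _ = (μ : ComplexMeasure S) {1} • (VectorMeasure.dirac (1 : S) (1 : ℂ)) E
  rw [density_apply, hρ, VectorMeasure.integral_indicator_const _ (measurableSet_singleton 1),
    VectorMeasure.restrict_apply _ hE (measurableSet_singleton 1)]
  by_cases h1 : (1 : S) ∈ E
  · have : ({1} : Set S) ∩ E = {1} := by simpa using h1
    simp [this, VectorMeasure.dirac_apply_of_mem hE h1]
  · have : ({1} : Set S) ∩ E = ∅ := by simpa using h1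
    simp [this, VectorMeasure.dirac_apply_of_notMem h1]

theorem norm_density_sub_le (ρ ρ' : SStar S) (μ : M S) :
    ‖density ρ μ - density ρ' μ‖ ≤
      ∫ s, ‖(ρ : S → ℝ) s - (ρ' : S → ℝ) s‖ ∂(μ : ComplexMeasure S).variation := by
  have hint := (semicharacter_integrable ρ μ).sub (semicharacter_integrable ρ' μ)
  have hw : (density ρ μ - density ρ' μ : M S) = (μ : ComplexMeasure S).withDensity
      ((ρ : S → ℝ) - (ρ' : S → ℝ)) (ContinuousLinearMap.lsmul ℝ ℝ) := by
    refine VectorMeasure.ext fun E hE => ?_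
    change (density ρ μ : ComplexMeasure S) E - (density ρ' μ : ComplexMeasure S) E = _
    rw [density_apply, density_apply, VectorMeasure.withDensity_apply hint]
    exact (VectorMeasure.integral_fun_sub (VectorMeasure.Integrable.restrict (semicharacter_integrable ρ μ))
      (VectorMeasure.Integrable.restrict (semicharacter_integrable ρ' μ))).symm
  have hle := (VectorMeasure.variation_WithDensity_le (μ := (μ : ComplexMeasure S))
    (f := (ρ : S → ℝ) - (ρ' : S → ℝ)) (B := ContinuousLinearMap.lsmul ℝ ℝ)) univ
  rw [← hw, VectorMeasure.variation_transpose_lsmul, withDensity_apply _ MeasurableSet.univ,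
    Measure.restrict_univ] at hle
  rw [norm_def, measureReal_def]
  refine le_trans ?_ (integral_norm_eq_lintegral_enorm hint.aestronglyMeasurable).ge
  exact ENNReal.toReal_mono hint.hasFiniteIntegral.ne hle

theorem norm_density_le (ρ : SStar S) (μ : M S) : ‖density ρ μ‖ ≤ ‖μ‖ := by
  rw [norm_def, norm_def]
  refine ENNReal.toReal_mono (measure_ne_top _ _) ?_
  have hle := (VectorMeasure.variation_WithDensity_le (μ := (μ : ComplexMeasure S))
    (f := (ρ : S → ℝ)) (B := ContinuousLinearMap.lsmul ℝ ℝ)) univ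
  refine hle.trans ?_
  rw [VectorMeasure.variation_transpose_lsmul, withDensity_apply _ MeasurableSet.univ,
    Measure.restrict_univ, ← lintegral_one]
  refine lintegral_mono fun s => ?_
  rw [Real.enorm_eq_ofReal (ρ.2.1 s).1]
  exact ENNReal.ofReal_le_one.2 (ρ.2.1 s).2

/-- `t ↦ ρ_t · μ` is norm continuous along a path of semicharacters. -/
theorem continuous_density (γ : C(I, SStar S)) (μ : M S) :
    Continuous fun t => density (γ t) μ := by
  rw [continuous_iff_continuousAt]
  intro t₀
  rw [ContinuousAt, tendsto_iff_norm_sub_tendsto_zero]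
  refine squeeze_zero (fun _ => norm_nonneg _) (fun t => norm_density_sub_le _ _ _) ?_
  have h : Tendsto (fun t => ∫ s, ‖(γ t : S → ℝ) s - (γ t₀ : S → ℝ) s‖
      ∂(μ : ComplexMeasure S).variation) (𝓝 t₀)
      (𝓝 (∫ _, (0 : ℝ) ∂(μ : ComplexMeasure S).variation)) := by
    -- Pointwise convergence suffices because neighbourhoods in the parameter interval are countably
    -- generated.
    refine tendsto_integral_filter_of_dominated_convergence (fun _ => 2)
      (Eventually.of_forall fun t =>
        ((semicharacter_integrable (γ t) μ).sub (semicharacter_integrable (γ t₀) μ)).aestronglyMeasurable.norm)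
      (Eventually.of_forall fun t => ae_of_all _ fun s => ?_) (integrable_const _)
      (ae_of_all _ fun s => ?_)
    · rw [norm_norm]
      refine (norm_sub_le _ _).trans ?_
      linarith [semicharacter_norm_le_one (γ t) s, semicharacter_norm_le_one (γ t₀) s]
    · have hc : Continuous fun t => (γ t : S → ℝ) s :=
        (continuous_apply s).comp (continuous_subtype_val.comp γ.continuous)
      have := ((hc.sub continuous_const).norm).tendsto' t₀ 0
        (by rw [sub_eq_zero.2 rfl, norm_zero] : ‖(γ t₀ : S → ℝ) s - (γ t₀ : S → ℝ) s‖ = 0)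
      exact this
  simpa using h

variable [LocallyCompactSpace S] [SeparatelyContinuousMul S]

/-- Both sides are bilinear, so positive measures suffice; there it is `posConv_withDensity`, as `ρ
(x * y)` splits under the double integral. -/
theorem density_conv (ρ : SStar S) (μ ν : M S) :
    density ρ (conv μ ν) = conv (density ρ μ) (density ρ ν) := by
  induction μ using M_induction with
  | hpos m =>
    induction ν using M_induction with
    | hpos n =>
      set f : S → ℝ≥0∞ := fun s => ENNReal.ofReal ((ρ : S → ℝ) s) with hf
      have h1 : (m.withDensity f).Regular := regular_of_le (withDensity_le ρ m)
      have h2 : (n.withDensity f).Regular := regular_of_le (withDensity_le ρ n)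
      have h3 : ((posConv m n).withDensity f).Regular := regular_of_le (withDensity_le ρ _)
      have i1 : IsFiniteMeasure (m.withDensity f) := isFiniteMeasure_of_le _ (withDensity_le ρ m)
      have i2 : IsFiniteMeasure (n.withDensity f) := isFiniteMeasure_of_le _ (withDensity_le ρ n)
      have i3 : IsFiniteMeasure ((posConv m n).withDensity f) :=
        isFiniteMeasure_of_le _ (withDensity_le ρ _)
      rw [conv_ofMeasure, density_ofMeasure, density_ofMeasure, density_ofMeasure, conv_ofMeasure]
      congr 1
      exact posConv_withDensity m n
        (fun a b => by rw [ρ.2.2.1, ENNReal.ofReal_mul (ρ.2.1 a).1])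
        (fun a => ENNReal.ofReal_ne_top) (semicharacter_aemeasurable ρ n).ennreal_ofReal
        (semicharacter_aemeasurable ρ _).ennreal_ofReal
    | hadd ν ν' h h' => rw [conv_add_right, density_add, h, h', density_add, conv_add_right]
    | hsmul c ν h => rw [conv_smul_right, density_smul, h, density_smul, conv_smul_right]
  | hadd μ μ' h h' => rw [conv_add_left, density_add, h, h', density_add, conv_add_left]
  | hsmul c μ h => rw [conv_smul_left, density_smul, h, density_smul, conv_smul_left]

theorem conv_dirac_one (μ : M S) : conv (dirac 1) μ = μ := by
  refine IsConv.conv_eq fun f => ?_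
  congr 1
  funext y
  change _ = (VectorMeasure.dirac (1 : S) (1 : ℂ)).integral (fun x => f (x * y)) _
  rw [VectorMeasure.integral_dirac]
  simp

end Density

/-! ### The Gelfand spectrum and the contraction -/

section Spectrum

variable {S : Type*} [CommMonoid S] [TopologicalSpace S] [T2Space S] [MeasurableSpace S]
  [BorelSpace S] {R : BanachSubalgebra S}

/-- The powers `μ, μ ∗ μ, …` of an element of `R`. -/
noncomputable def convPow (μ : R.toSubmodule) : ℕ → R.toSubmodule
  | 0 => μ
  | n + 1 => ⟨conv (convPow μ n : M S) (μ : M S), R.conv_mem' _ (convPow μ n).2 _ μ.2⟩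

theorem apply_convPow {φ : WeakDual ℂ R.toSubmodule} (hφ : φ ∈ GelfandSpectrum R)
    (μ : R.toSubmodule) (n : ℕ) : φ (convPow μ n) = φ μ ^ (n + 1) := by
  induction n with
  | zero => simp [convPow]
  | succ n ih => rw [convPow, hφ.2, ih, pow_succ _ (n + 1)]

variable [LocallyCompactSpace S] [SeparatelyContinuousMul S]

theorem norm_convPow_le (μ : R.toSubmodule) (n : ℕ) :
    ‖convPow μ n‖ ≤ (16 * ‖μ‖) ^ (n + 1) := by
  induction n with
  | zero => rw [convPow, zero_add, pow_one]; linarith [norm_nonneg μ]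
  | succ n ih =>
    calc ‖convPow μ (n + 1)‖ ≤ 16 * (‖convPow μ n‖ * ‖μ‖) := norm_conv_le _ _
      _ ≤ 16 * ((16 * ‖μ‖) ^ (n + 1) * ‖μ‖) := by gcongr
      _ = _ := by ring

theorem le_of_forall_pow_le_mul_pow {x q C : ℝ} (hx : 0 ≤ x) (hq : 0 ≤ q)
    (h : ∀ n : ℕ, x ^ (n + 1) ≤ C * q ^ (n + 1)) : x ≤ q := by
  by_contra! hlt
  have hx0 : 0 < x := hq.trans_lt hlt
  have hlim : Tendsto (fun n : ℕ => C * (q / x) ^ (n + 1)) atTop (𝓝 (C * 0)) :=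
    ((tendsto_pow_atTop_nhds_zero_of_lt_one (div_nonneg hq hx)
      ((div_lt_one hx0).2 hlt)).comp (tendsto_add_atTop_nat 1)).const_mul C
  have h1 : (1 : ℝ) ≤ C * 0 := ge_of_tendsto' hlim fun n => by
    rw [div_pow, mul_div_assoc', le_div_iff₀ (by positivity), one_mul]
    exact h n
  linarith

/-- The characters of `R` are uniformly bounded. -/
theorem norm_apply_le_of_mem_GelfandSpectrum {φ : WeakDual ℂ R.toSubmodule}
    (hφ : φ ∈ GelfandSpectrum R) (μ : R.toSubmodule) : ‖φ μ‖ ≤ 16 * ‖μ‖ := by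
  -- Compare `φ μ ^ (n + 1)` with the norm of the convolution power: the unknown `‖φ‖` enters only
  -- once and disappears on taking roots.
  refine le_of_forall_pow_le_mul_pow (C := ‖WeakDual.toStrongDual φ‖) (norm_nonneg _)
    (by positivity) fun n => ?_
  rw [← norm_pow, ← apply_convPow hφ]
  calc ‖φ (convPow μ n)‖ ≤ ‖WeakDual.toStrongDual φ‖ * ‖convPow μ n‖ :=
        (WeakDual.toStrongDual φ).le_opNorm _
    _ ≤ _ := by gcongr; exact norm_convPow_le μ n

/-- The unit `δ_e` of `R`. -/
noncomputable def unit (R : BanachSubalgebra S) : R.toSubmodule := ⟨dirac 1, R.one_mem'⟩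

theorem apply_unit {φ : WeakDual ℂ R.toSubmodule} (hφ : φ ∈ GelfandSpectrum R) :
    φ (unit R) = 1 := by
  obtain ⟨μ, hμ⟩ : ∃ μ, φ μ ≠ 0 := by
    by_contra! h
    exact hφ.1 (ContinuousLinearMap.ext h)
  have h := hφ.2 (unit R) μ
  have h1 : (⟨conv (unit R : M S) (μ : M S), R.conv_mem' _ (unit R).2 _ μ.2⟩ : R.toSubmodule) = μ :=
    Subtype.ext (conv_dirac_one _)
  rw [h1] at h
  exact (mul_eq_right₀ hμ).1 h.symm

/-- Multiplication by a semicharacter that leaves `R` invariant, as an operator on `R`. -/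
noncomputable def densityOp (ρ : SStar S) (h : ∀ μ ∈ R.toSubmodule, density ρ μ ∈ R.toSubmodule) :
    R.toSubmodule →L[ℂ] R.toSubmodule :=
  LinearMap.mkContinuous
    { toFun := fun μ => ⟨density ρ μ, h μ μ.2⟩
      map_add' := fun μ ν => Subtype.ext (density_add ρ μ ν)
      map_smul' := fun c μ => Subtype.ext (density_smul ρ c μ) } 1
    fun μ => by rw [one_mul]; exact norm_density_le ρ μ

/-- The character `μ ↦ φ (ρ · μ)`. -/
noncomputable def compDensity (ρ : SStar S) (h : ∀ μ ∈ R.toSubmodule, density ρ μ ∈ R.toSubmodule)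
    (φ : GelfandSpectrum R) : GelfandSpectrum R :=
  ⟨StrongDual.toWeakDual ((WeakDual.toStrongDual (φ : WeakDual ℂ R.toSubmodule)).comp
      (densityOp ρ h)), by
    have hone : densityOp ρ h (unit R) = unit R := Subtype.ext (density_dirac_one ρ)
    refine ⟨fun h0 => ?_, fun μ ν => ?_⟩
    · have h1 : (φ : WeakDual ℂ R.toSubmodule) (densityOp ρ h (unit R)) = 0 :=
        congrArg (fun ψ : WeakDual ℂ R.toSubmodule => ψ (unit R)) h0
      rw [hone, apply_unit φ.2] at h1
      exact one_ne_zero h1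
    · refine Eq.trans ?_ (φ.2.2 (densityOp ρ h μ) (densityOp ρ h ν))
      exact congrArg (φ : WeakDual ℂ R.toSubmodule) (Subtype.ext (density_conv ρ μ ν))⟩

/-- Split the change at `(t₀, φ₀)` into `φ (ρ_t · μ - ρ_{t₀} · μ)`, small by the bound uniform in
`φ`, and `(φ - φ₀) (ρ_{t₀} · μ)`, small by weak-* convergence. -/
theorem continuous_compDensity {γ : C(I, SStar S)} (h : StableUnder R γ) :
    Continuous fun p : I × GelfandSpectrum R =>
      compDensity (γ p.1) (fun μ hμ => h μ hμ p.1) p.2 := by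
  refine Continuous.subtype_mk (WeakDual.continuous_of_continuous_eval fun μ => ?_) _
  change Continuous fun p : I × GelfandSpectrum R =>
    (p.2 : WeakDual ℂ R.toSubmodule) (densityOp (γ p.1) (fun μ hμ => h μ hμ p.1) μ)
  have hD : Continuous fun t : I => densityOp (γ t) (fun μ hμ => h μ hμ t) μ :=
    (continuous_density γ (μ : M S)).subtype_mk _
  rw [continuous_iff_continuousAt]
  rintro ⟨t₀, φ₀⟩
  have h1 : Tendsto (fun p : I × GelfandSpectrum R => (p.2 : WeakDual ℂ R.toSubmodule)
      (densityOp (γ p.1) (fun μ hμ => h μ hμ p.1) μ - densityOp (γ t₀) (fun μ hμ => h μ hμ t₀) μ))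
      (𝓝 (t₀, φ₀)) (𝓝 0) := by
    refine squeeze_zero_norm (fun p => norm_apply_le_of_mem_GelfandSpectrum p.2.2 _) ?_
    have hc : Continuous fun p : I × GelfandSpectrum R =>
        16 * ‖densityOp (γ p.1) (fun μ hμ => h μ hμ p.1) μ -
          densityOp (γ t₀) (fun μ hμ => h μ hμ t₀) μ‖ :=
      ((((hD.comp continuous_fst).sub continuous_const).norm).const_mul 16)
    exact hc.tendsto' _ _ (by simp)
  have h2 : Tendsto (fun p : I × GelfandSpectrum R => (p.2 : WeakDual ℂ R.toSubmodule)
      (densityOp (γ t₀) (fun μ hμ => h μ hμ t₀) μ)) (𝓝 (t₀, φ₀))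
      (𝓝 ((φ₀ : WeakDual ℂ R.toSubmodule) (densityOp (γ t₀) (fun μ hμ => h μ hμ t₀) μ))) :=
    ((WeakDual.eval_continuous _).comp (continuous_subtype_val.comp continuous_snd)).tendsto _
  have h3 := h1.add h2
  rw [zero_add] at h3
  refine h3.congr fun p => ?_
  rw [← map_add, sub_add_cancel]

/-- The character `μ ↦ μ({e})`, available when `R` is stable under the semicharacter `1_e`. -/
theorem exists_character_apply_singleton {ρ : SStar S}
    (hρ : (ρ : S → ℝ) = Set.indicator {1} fun _ => 1) :
    ∃ φ : GelfandSpectrum R, ∀ μ : R.toSubmodule,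
      (φ : WeakDual ℂ R.toSubmodule) μ = ((μ : M S) : ComplexMeasure S) {1} := by
  let φ : R.toSubmodule →L[ℂ] ℂ := LinearMap.mkContinuous
    { toFun := fun μ => ((μ : M S) : ComplexMeasure S) {1}
      map_add' := fun μ ν => rfl
      map_smul' := fun c μ => rfl } 1
    fun μ => by rw [one_mul]; exact norm_apply_le (μ : M S) {1}
  have hdirac : ((dirac 1 : M S) : ComplexMeasure S) {(1 : S)} = 1 :=
    VectorMeasure.dirac_apply_of_mem (measurableSet_singleton 1) rfl
  refine ⟨⟨StrongDual.toWeakDual φ, fun h0 => ?_, fun μ ν => ?_⟩, fun μ => rfl⟩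
  · have h1 : ((dirac 1 : M S) : ComplexMeasure S) {(1 : S)} = 0 :=
      congrArg (fun ψ : WeakDual ℂ R.toSubmodule => ψ (unit R)) h0
    rw [hdirac] at h1
    exact one_ne_zero h1
  · change (conv (μ : M S) (ν : M S) : ComplexMeasure S) {1} =
      ((μ : M S) : ComplexMeasure S) {1} * ((ν : M S) : ComplexMeasure S) {1}
    -- Multiplicativity is `density_conv` for `1_e`: it equates multiples of `δ_e`, whose
    -- coefficients are read off at `{e}`.
    have h := density_conv ρ (μ : M S) (ν : M S)
    rw [density_indicator_one hρ, density_indicator_one hρ, density_indicator_one hρ,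
      conv_smul_left, conv_smul_right, conv_dirac_one] at h
    have h' := congrArg (fun κ : M S => (κ : ComplexMeasure S) {1}) h
    change _ * ((dirac 1 : M S) : ComplexMeasure S) {(1 : S)} =
      _ * (_ * ((dirac 1 : M S) : ComplexMeasure S) {(1 : S)}) at h'
    simpa [hdirac] using h'

theorem contractibleSpace_GelfandSpectrum {γ : C(I, SStar S)} (hγ : IsPathToUnit γ)
    (h : StableUnder R γ) : ContractibleSpace (GelfandSpectrum R) := by
  obtain ⟨φe, hφe⟩ := exists_character_apply_singleton (R := R) hγ.2
  rw [contractible_iff_id_nullhomotopic]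
  refine ⟨φe, ⟨⟨⟨_, continuous_compDensity h⟩, fun φ => ?_, fun φ => ?_⟩⟩⟩
  · refine Subtype.ext (ContinuousLinearMap.ext fun μ => ?_)
    refine congrArg (φ : WeakDual ℂ R.toSubmodule) (Subtype.ext ?_)
    exact density_eq_self (Eventually.of_forall fun s => congrFun hγ.1 s)
  · refine Subtype.ext (ContinuousLinearMap.ext fun μ => ?_)
    change (φ : WeakDual ℂ R.toSubmodule) (densityOp (γ 1) (fun μ hμ => h μ hμ 1) μ) =
      (φe : WeakDual ℂ R.toSubmodule) μ
    have hD : densityOp (γ 1) (fun μ hμ => h μ hμ 1) μ =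
        ((μ : M S) : ComplexMeasure S) {1} • unit R :=
      Subtype.ext (density_indicator_one hγ.2 (μ : M S))
    rw [hD, map_smul, apply_unit φ.2, hφe, smul_eq_mul, mul_one]

end Spectrum

/-! ### The path of powers of a semicharacter -/

section PowerPath

variable {S : Type*} [CommMonoid S] [TopologicalSpace S] [T2Space S] [MeasurableSpace S]
  [BorelSpace S] {ρ : S → ℝ}

theorem rpow_mem_SStar (hρ : ρ ∈ SStar S) {r : ℝ} (hr : 0 ≤ r) : (fun s => ρ s ^ r) ∈ SStar S := by
  refine ⟨fun s => ⟨Real.rpow_nonneg (hρ.1 s).1 r, Real.rpow_le_one (hρ.1 s).1 (hρ.1 s).2 hr⟩,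
    fun a b => ?_, ⟨1, ?_⟩, fun μ => (hρ.2.2.2 μ).pow_const r⟩
  · simp only [hρ.2.1, Real.mul_rpow (hρ.1 a).1 (hρ.1 b).1]
  · simp [map_one_of_mem_SStar hρ]

theorem indicator_one_mem_SStar (hρ : ρ ∈ SStar S) (hlt : ∀ s, s ≠ 1 → ρ s < 1) :
    Set.indicator {(1 : S)} (fun _ => (1 : ℝ)) ∈ SStar S := by
  -- The complement of `{e}` is an ideal: `a * b = e` gives `ρ a * ρ b = 1` with both factors in
  -- `[0, 1]`, so `ρ a = 1` and `a = e`. This makes `1_e` multiplicative.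
  have hunit : ∀ a b : S, a * b = 1 → a = 1 := fun a b hab => by
    by_contra ha
    have h1 : ρ a * ρ b = 1 := by rw [← hρ.2.1, hab, map_one_of_mem_SStar hρ]
    have h2 : ρ a * ρ b ≤ ρ a := mul_le_of_le_one_right (hρ.1 a).1 (hρ.1 b).2
    linarith [hlt a ha]
  refine ⟨fun s => ?_, fun a b => ?_, ⟨1, by simp⟩,
    fun μ => (measurable_const.indicator (measurableSet_singleton 1)).aemeasurable⟩
  · by_cases hs : s = 1 <;> simp [hs]
  · by_cases ha : a = 1
    · by_cases hb : b = 1 <;> simp [ha, hb, Set.indicator]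
    · have hab : a * b ≠ 1 := fun h => ha (hunit a b h)
      simp [ha, hab]

/-- The exponent tends to infinity at `t = 1` and the base is below `1`. The case split is needed
since at `t = 1` division by zero would give exponent `0` and value `1`. -/
theorem continuous_rpow_div_one_sub {x : ℝ} (hx0 : 0 < x) (hx1 : x < 1) :
    Continuous fun t : I => if t = 1 then (0 : ℝ) else x ^ ((t : ℝ) / (1 - t)) := by
  rw [continuous_iff_continuousAt]
  intro t₀
  by_cases ht : t₀ = 1
  · subst ht
    rw [ContinuousAt, if_pos rfl, ← nhdsNE_sup_pure, tendsto_sup]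
    refine ⟨?_, tendsto_pure_left.2 fun s hs => by simpa using mem_of_mem_nhds hs⟩
    have hne : ∀ᶠ t : I in 𝓝[≠] 1, t ≠ 1 := eventually_mem_nhdsWithin
    have hexp : Tendsto (fun t : I => (t : ℝ) / (1 - t)) (𝓝[≠] 1) atTop := by
      have h1 : Tendsto (fun t : I => (t : ℝ)) (𝓝[≠] 1) (𝓝 1) :=
        (continuous_subtype_val.tendsto' (1 : I) 1 rfl).mono_left nhdsWithin_le_nhds
      have h2 : Tendsto (fun t : I => 1 - (t : ℝ)) (𝓝[≠] 1) (𝓝[>] 0) := by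
        refine tendsto_nhdsWithin_iff.2 ⟨by simpa using h1.const_sub 1, ?_⟩
        filter_upwards [hne] with t ht
        have : (t : ℝ) < 1 := lt_of_le_of_ne t.2.2 fun h => ht (Subtype.ext h)
        simpa using this
      exact h1.pos_mul_atTop one_pos (tendsto_inv_nhdsGT_zero.comp h2)
    refine ((tendsto_rpow_atTop_of_base_lt_one x (by linarith) hx1).comp hexp).congr' ?_
    filter_upwards [hne] with t ht
    simp [ht]
  · have hcont : ContinuousAt (fun t : I => x ^ ((t : ℝ) / (1 - t))) t₀ := by
      have h0 : (1 : ℝ) - t₀ ≠ 0 := fun h => ht (Subtype.ext (by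
        have : (t₀ : ℝ) = 1 := by linarith
        exact this))
      -- A positive base matters at `t = 0`: with base `0` the value would jump from `0 ^ 0 = 1` to
      -- `0`.
      refine ContinuousAt.rpow continuousAt_const ?_ (Or.inl hx0.ne')
      exact continuous_subtype_val.continuousAt.div
        (continuousAt_const.sub continuous_subtype_val.continuousAt) h0
    refine hcont.congr ?_
    filter_upwards [isOpen_ne.mem_nhds ht] with t ht
    simp [show t ≠ 1 from ht]

theorem exists_power_path (hρ : ρ ∈ SStar S) (hρ01 : ∀ s, s ≠ 1 → 0 < ρ s ∧ ρ s < 1) :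
    ∃ γ : C(I, SStar S), IsPathToUnit γ ∧ ∀ t : I, t ≠ 1 → ∀ s : S,
      (γ t : S → ℝ) s = ρ s ^ ((t : ℝ) / (1 - (t : ℝ))) := by
  classical
  have hnn : ∀ t : I, 0 ≤ (t : ℝ) / (1 - t) := fun t => div_nonneg t.2.1 (sub_nonneg.2 t.2.2)
  let g : I → SStar S := fun t =>
    if t = 1 then ⟨_, indicator_one_mem_SStar hρ fun s hs => (hρ01 s hs).2⟩
    else ⟨_, rpow_mem_SStar hρ (hnn t)⟩
  have hg1 : (g 1 : S → ℝ) = Set.indicator {1} fun _ => 1 := by simp [g]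
  have hg : ∀ t, t ≠ 1 → (g t : S → ℝ) = fun s => ρ s ^ ((t : ℝ) / (1 - t)) := fun t ht => by
    simp [g, ht]
  refine ⟨⟨g, continuous_induced_rng.2 (continuous_pi fun s => ?_)⟩, ⟨?_, hg1⟩,
    fun t ht s => congrFun (hg t ht) s⟩
  · by_cases hs : s = 1
    · refine continuous_const (y := (1 : ℝ)) |>.congr fun t => ?_
      exact (by rw [hs, map_one_of_mem_SStar (g t).2] : (1 : ℝ) = (g t : S → ℝ) s)
    · refine (continuous_rpow_div_one_sub (hρ01 s hs).1 (hρ01 s hs).2).congr fun t => ?_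
      change _ = (g t : S → ℝ) s
      by_cases ht : t = 1
      · simp [ht, hg1, hs]
      · simp [ht, hg]
  · change (g 0 : S → ℝ) = _
    rw [hg 0 zero_ne_one]
    simp

end PowerPath

end SemigroupMeasure

theorem corollary2 {S : Type*} [CommMonoid S] [TopologicalSpace S] [T2Space S]
    [LocallyCompactSpace S] [SeparatelyContinuousMul S] [MeasurableSpace S] [BorelSpace S]
    (hinv : ∀ s : S, IsUnit s → s = 1)
    (ρ : S → ℝ) (hρ : ρ ∈ SemigroupMeasure.SStar S)
    (hρ01 : ∀ s : S, s ≠ 1 → 0 < ρ s ∧ ρ s < 1) :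
    (∃ γ : C(unitInterval, SemigroupMeasure.SStar S),
      SemigroupMeasure.IsPathToUnit γ ∧
      ∀ t : unitInterval, t ≠ 1 → ∀ s : S,
        (γ t : S → ℝ) s = ρ s ^ ((t : ℝ) / (1 - (t : ℝ)))) ∧
    ∀ R : SemigroupMeasure.BanachSubalgebra S,
      (∃ γ : C(unitInterval, SemigroupMeasure.SStar S),
        SemigroupMeasure.IsPathToUnit γ ∧ SemigroupMeasure.StableUnder R γ) →
      ContractibleSpace (SemigroupMeasure.GelfandSpectrum R) :=
  ⟨SemigroupMeasure.exists_power_path hρ hρ01, fun _ ⟨_, hγ, h⟩ =>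
    SemigroupMeasure.contractibleSpace_GelfandSpectrum hγ h⟩
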